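/- **Setting.** Let $1\le k<n$ and $q\ge 1$ be integers, $X\in\mathbb{R}^{n\times k}$ with $\operatorname{rank}X=k$, $R\in\mathbb{R}^{q\times k}$ with $\operatorname{rank}R=q$, and $r\in\mathbb{R}^q$. Put $\mathfrak{M}_0=\{X\beta: R\beta=r\}$ and let $\mathfrak{M}_0^{lin}=\{X\beta:R\beta=0\}$ be the parallel linear space. Let $\mathfrak{F}_{\mathrm{all}}$ be the set of all normalized spectral densities, i.e. even integrable $f:[-\pi,\pi]\to[0,\infty)$ with $\int_{-\pi}^{\pi}f=1$, and let $\Sigma(f)=\big[\int_{-\pi}^{\pi}e^{-\iota(j-l)\omega}f(\omega)\,d\omega\big]_{j,l=1}^n$. $P_{\mu,A}$ is the Gaussian distribution on $\mathbb{R}^n$ with mean $\mu$ and covariance matrix $A$. For $\mathfrak{F}\subseteq\mathfrak{F}_{\mathrm{all}}$, $T:\mathbb{R}^n\to\mathbb{R}$ and $C\in\mathbb{R}$ put $$s(C)=s_{T,\mathfrak{F}}(C)=\sup_{\mu_0\in\mathfrak{M}_0}\ \sup_{0<\sigma^2<\infty}\ \sup_{f\in\mathfrak{F}}P_{\mu_0,\sigma^2\Sigma(f)}(T\ge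 C).$$ **Test statistic.** Let $\hat\beta(y)=(X'X)^{-1}X'y$, $\hat u(y)=y-X\hat\beta(y)$, $\hat v_t(y)=\hat u_t(y)x_{t\cdot}'$ ($x_{t\cdot}$ the $t$-th row of $X$), $\hat\Gamma_j(y)=n^{-1}\sum_{t=j+1}^n\hat v_t(y)\hat v_{t-j}(y)'$ for $j\ge0$, $\hat\Gamma_j=\hat\Gamma_{-j}'$ for $j<0$, $\hat\Psi_w=\sum_{|j|\le n-1}w(j,n)\hat\Gamma_j$ and $\hat\Omega_w=nR(X'X)^{-1}\hat\Psi_w(X'X)^{-1}R'$. Then $T_w(y)=(R\hat\beta(y)-r)'\hat\Omega_w^{-1}(y)(R\hat\beta(y)-r)$ if $\det\hat\Omega_w(y)\neq0$, and $T_w(y)=0$ otherwise. Let $\mathsf{B}=\{y:\operatorname{rank}(R(X'X)^{-1}X'\operatorname{diag}(\hat u_1(y),\dots,\hat u_n(y)))<q\}$. *Assumption AW:* the (non-random) weights satisfy $w(0,n)=1$, $w(-j,n)=w(j,n)$, and the matrix $[w(i-j,n)]_{i,j=1}^n$ is positive definite. *Assumption R_and_X:* deleting from $X'$ all columns whose index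 $i$ is such that the standard basis vector $e_i(n)$ lies in $\operatorname{span}(X)$ (the column space of $X$), the resulting matrix $X'_{\neg}$ satisfies $\operatorname{rank}(R(X'X)^{-1}X'_{\neg})=q$. **Frequencies.** For $\omega\in[0,\pi]$ and an integer $s\ge0$ let $E_{n,s}(\omega)$ be the $n\times2$ matrix with $j$-th row $(j^s\cos(j\omega),j^s\sin(j\omega))$, $j=1,\dots,n$. For a linear subspace $\mathcal{L}\subseteq\mathbb{R}^n$ with $\dim\mathcal{L}<n$ let $\rho(\omega,\mathcal{L})=\min\{s\ge0:\operatorname{span}(E_{n,s}(\omega))\not\subseteq\mathcal{L}\}$; the set $Z=\{\omega\in[0,\pi]:\rho(\omega,\mathcal{L})>0\}$ is finite. For $d\in\mathbb{N}$ put $\kappa(\omega,d)=d$ and $\Delta_\omega(z)=1-\cos(\omega)z$ if $\omega\in\{0,\pi\}$, and $\kappa(\omega,d)=2d$ and $\Delta_\omega(z)=1-2\cos(\omega)z+z^2$ if $\omega\in(0,\pi)$. Put $\kappa(\mathcal{L})=\sum_{\omega\in Z}\kappa(\omega,\rho(\omega,\mathcal{L}))$ and $\Delta_{\mathcal{L}}=\prod_{\omega\in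 Z}\Delta_\omega^{\rho(\omega,\mathcal{L})}$. Let $\mathbb{M}(\mathfrak{F},\mathcal{L})$ be the set of all finite symmetric Borel measures $\mathsf{m}$ on $[-\pi,\pi]$ with finite support such that (i) for some sequence $f_j\in\mathfrak{F}$, $\mathsf{m}$ is the weak limit of the measures with Lebesgue densities $|\Delta_{\mathcal{L}}(e^{\iota\nu})|^2f_j(\nu)\big/\int_{-\pi}^{\pi}|\Delta_{\mathcal{L}}(e^{\iota\nu})|^2f_j(\nu)\,d\nu$, and (ii) $\sum_{\gamma\in\operatorname{supp}(\mathsf{m})\cap[0,\pi]}\kappa(\gamma,1)<n-\kappa(\mathcal{L})$. Let $\mathbb{S}(\mathfrak{F},\mathcal{L})=\{\operatorname{supp}(\mathsf{m})\cap[0,\pi]:\mathsf{m}\in\mathbb{M}(\mathfrak{F},\mathcal{L})\}$. **The constant $\alpha^*$.** Let $\Pi$ be the orthogonal projection onto $(\mathfrak{M}_0^{lin})^\perp$ and let $\mathbb{J}$ be the set of all column spaces $\operatorname{span}(\bar\Sigma)$ of matrices $\bar\Sigma$ in the closure of $\{\Pi\Sigma(f)\Pi/\|\Pi\Sigma(f)\Pi\|:f\in\mathfrak{F}\}$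 in $\mathbb{R}^{n\times n}$ with $\operatorname{rank}\bar\Sigma<n-\dim\mathfrak{M}_0^{lin}$ (the choice of the norm is immaterial). Let $\mathbb{H}$ be the set of those $\mathcal{S}\in\mathbb{J}$ for which, for some $\mu_0\in\mathfrak{M}_0$, $T_w$ is equal to a constant $C(\mathcal{S})$ almost everywhere on $\mu_0+\mathcal{S}$ with respect to Lebesgue measure on $\mu_0+\mathcal{S}$; let $C^*=\sup_{\mathcal{S}\in\mathbb{H}}C(\mathcal{S})$ ($=-\infty$ if $\mathbb{H}=\emptyset$) and $\alpha^*=\sup_{C\in(C^*,\infty)}s_{T_w,\mathfrak{F}}(C)$. **Theorem.** Let $\mathfrak{F}\subseteq\mathfrak{F}_{\mathrm{all}}$ be nonempty and suppose Assumptions AW and R_and_X hold. Write $\rho(\gamma)=\rho(\gamma,\mathfrak{M}_0^{lin})$ and $\mathbb{S}=\mathbb{S}(\mathfrak{F},\mathfrak{M}_0^{lin})$. 1. Suppose that $$\operatorname{span}\big(E_{n,\rho(\gamma_1)}(\gamma_1),\dots,E_{n,\rho(\gamma_p)}(\gamma_p)\big)\not\subseteq\mathsf{B}\qquad(\ast)$$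 for every $\Gamma=\{\gamma_1,\dots,\gamma_p\}\in\mathbb{S}$ ($p=\operatorname{card}\Gamma$). Then for every $0<\alpha<1$ there is a real number $C(\alpha)$ with $s_{T_w,\mathfrak{F}}(C(\alpha))\le\alpha$; and for every $\alpha\in(0,\alpha^*]\cap(0,1)$ there is a real number $C(\alpha)$ with $s_{T_w,\mathfrak{F}}(C(\alpha))=\alpha$. 2. A sufficient condition for $(\ast)$ to hold for every $\Gamma\in\mathbb{S}$ is that $$\operatorname{span}\big(E_{n,\rho(\gamma)}(\gamma)\big)\not\subseteq\mathsf{B}\qquad(\ast\ast)$$ for every $\gamma\in\bigcup\mathbb{S}$; this in turn holds if $(\ast\ast)$ holds for every $\gamma\in[0,\pi]$. 3. If $\mathsf{B}=\operatorname{span}(X)$, then for every $\Gamma=\{\gamma_1,\dots,\gamma_p\}\in\mathbb{S}$ condition $(\ast)$ is equivalent to $\operatorname{rank}(X,E_{n,\rho(\gamma_1)}(\gamma_1),\dots,E_{n,\rho(\gamma_p)}(\gamma_p))>k$, and for every $\gamma\in[0,\pi]$ condition $(\ast\ast)$ is equivalent to $\operatorname{rank}(X,E_{n,\rho(\gamma)}(\gamma))>k$.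 -/

import Mathlib

open scoped Matrix

namespace SizeControl

noncomputable section

/-- The column space of a matrix with `n` rows, as a linear subspace of Euclidean space. -/
def colSpan {n : ℕ} {m : Type} (A : Matrix (Fin n) m ℝ) :
    Submodule ℝ (EuclideanSpace ℝ (Fin n)) :=
  Submodule.span ℝ (Set.range fun j : m => WithLp.toLp 2 (fun i : Fin n => A i j))

/-! ### The testing problem -/

/-- The affine space `{Xβ : Rβ = r}` of mean vectors satisfying the null hypothesis. -/
def M0 {n k q : ℕ} (X : Matrix (Fin n) (Fin k) ℝ) (R : Matrix (Fin q) (Fin k) ℝ)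
    (r : Fin q → ℝ) : Set (EuclideanSpace ℝ (Fin n)) :=
  {μ | ∃ β : Fin k → ℝ, μ = WithLp.toLp 2 (X *ᵥ β) ∧ R *ᵥ β = r}

/-- The linear space `{Xβ : Rβ = 0}` parallel to `M0 X R r`; see `coe_M0lin`. -/
def M0lin {n k q : ℕ} (X : Matrix (Fin n) (Fin k) ℝ) (R : Matrix (Fin q) (Fin k) ℝ) :
    Submodule ℝ (EuclideanSpace ℝ (Fin n)) where
  carrier := {v | ∃ β : Fin k → ℝ, v = WithLp.toLp 2 (X *ᵥ β) ∧ R *ᵥ β = 0}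
  add_mem' := by
    rintro _ _ ⟨β, rfl, hβ⟩ ⟨β', rfl, hβ'⟩
    exact ⟨β + β', by simp [Matrix.mulVec_add], by simp [Matrix.mulVec_add, hβ, hβ']⟩
  zero_mem' := ⟨0, by simp, by simp⟩
  smul_mem' := by
    rintro c _ ⟨β, rfl, hβ⟩
    exact ⟨c • β, by simp [Matrix.mulVec_smul], by simp [Matrix.mulVec_smul, hβ]⟩

theorem coe_M0lin {n k q : ℕ} (X : Matrix (Fin n) (Fin k) ℝ) (R : Matrix (Fin q) (Fin k) ℝ)
    (r : Fin q → ℝ) (μ₀ : EuclideanSpace ℝ (Fin n)) (hμ₀ : μ₀ ∈ M0 X R r) :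
    (M0lin X R : Set (EuclideanSpace ℝ (Fin n))) = {v | ∃ μ ∈ M0 X R r, v = μ - μ₀} := by
  obtain ⟨β₀, rfl, hβ₀⟩ := hμ₀
  ext v
  constructor
  · rintro ⟨β, rfl, hβ⟩
    exact ⟨_, ⟨β + β₀, rfl, by simp [Matrix.mulVec_add, hβ, hβ₀]⟩, by simp [Matrix.mulVec_add]⟩
  · rintro ⟨_, ⟨β, rfl, hβ⟩, rfl⟩
    exact ⟨β - β₀, by simp [Matrix.mulVec_sub], by simp [Matrix.mulVec_sub, hβ, hβ₀]⟩

/-- The normalized spectral densities, as functions on the real line of which only the values on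
`[-π, π]` are ever used. -/
def Fall : Set (ℝ → ℝ) :=
  {f | (∀ ω ∈ Set.Icc (-Real.pi) Real.pi, 0 ≤ f ω ∧ f (-ω) = f ω) ∧
    MeasureTheory.IntegrableOn f (Set.Icc (-Real.pi) Real.pi) ∧
    ∫ ω in Set.Icc (-Real.pi) Real.pi, f ω = 1}

/-- The `n × n` covariance matrix with spectral density `f`. The integral is real since `f` is
even, so that taking the real part is only a change of type. -/
def Sig (n : ℕ) (f : ℝ → ℝ) : Matrix (Fin n) (Fin n) ℝ :=
  Matrix.of fun j l =>
    (∫ ω in Set.Icc (-Real.pi) Real.pi,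
      Complex.exp (-(Complex.I * (((j : ℕ) : ℂ) - ((l : ℕ) : ℂ)) * (ω : ℂ))) * (f ω : ℂ)).re

/-- The size of the test that rejects when `T ≥ C`: the supremum of the rejection probabilities
under Gaussian distributions with mean in `M₀` and covariance matrix `σ² Σ(f)`, `f ∈ F`. -/
def size {n : ℕ} (M₀ : Set (EuclideanSpace ℝ (Fin n))) (F : Set (ℝ → ℝ))
    (T : EuclideanSpace ℝ (Fin n) → ℝ) (C : ℝ) : ENNReal :=
  ⨆ μ₀ ∈ M₀, ⨆ σ2 ∈ Set.Ioi (0 : ℝ), ⨆ f ∈ F,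
    ProbabilityTheory.multivariateGaussian μ₀ (σ2 • Sig n f) {y | C ≤ T y}

/-! ### The test statistic -/

/-- The ordinary least squares estimator. -/
def betaHat {n k : ℕ} (X : Matrix (Fin n) (Fin k) ℝ) (y : EuclideanSpace ℝ (Fin n)) :
    Fin k → ℝ :=
  ((Xᵀ * X)⁻¹ * Xᵀ) *ᵥ y.ofLp

/-- The ordinary least squares residuals. -/
def uHat {n k : ℕ} (X : Matrix (Fin n) (Fin k) ℝ) (y : EuclideanSpace ℝ (Fin n)) :
    Fin n → ℝ :=
  y.ofLp - X *ᵥ betaHat X y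

/-- The vectors `v̂_t = û_t x_t'`. -/
def vHat {n k : ℕ} (X : Matrix (Fin n) (Fin k) ℝ) (y : EuclideanSpace ℝ (Fin n)) (t : Fin n) :
    Fin k → ℝ :=
  uHat X y t • X t

/-- The empirical autocovariance matrix at lag `j ≥ 0`; the sum is over all pairs of time points
`t, s` with `s = t - j`. -/
def gammaHatNat {n k : ℕ} (X : Matrix (Fin n) (Fin k) ℝ) (y : EuclideanSpace ℝ (Fin n)) (j : ℕ) :
    Matrix (Fin k) (Fin k) ℝ :=
  (n : ℝ)⁻¹ • ∑ t : Fin n, ∑ s : Fin n,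
    if (t : ℕ) = (s : ℕ) + j then Matrix.vecMulVec (vHat X y t) (vHat X y s) else 0

/-- The empirical autocovariance matrix at lag `j`. -/
def gammaHat {n k : ℕ} (X : Matrix (Fin n) (Fin k) ℝ) (y : EuclideanSpace ℝ (Fin n)) (j : ℤ) :
    Matrix (Fin k) (Fin k) ℝ :=
  if 0 ≤ j then gammaHatNat X y j.toNat else (gammaHatNat X y (-j).toNat)ᵀ

def psiHat {n k : ℕ} (w : ℤ → ℝ) (X : Matrix (Fin n) (Fin k) ℝ)
    (y : EuclideanSpace ℝ (Fin n)) : Matrix (Fin k) (Fin k) ℝ :=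
  ∑ j ∈ Finset.Icc (-((n : ℤ) - 1)) ((n : ℤ) - 1), w j • gammaHat X y j

def omegaHat {n k q : ℕ} (w : ℤ → ℝ) (X : Matrix (Fin n) (Fin k) ℝ)
    (R : Matrix (Fin q) (Fin k) ℝ) (y : EuclideanSpace ℝ (Fin n)) : Matrix (Fin q) (Fin q) ℝ :=
  (n : ℝ) • (R * (Xᵀ * X)⁻¹ * psiHat w X y * (Xᵀ * X)⁻¹ * Rᵀ)

open Classical in
/-- The autocorrelation robust test statistic with weights `w j = w(j, n)`, `|j| ≤ n - 1`. -/
def Tw {n k q : ℕ} (w : ℤ → ℝ) (X : Matrix (Fin n) (Fin k) ℝ) (R : Matrix (Fin q) (Fin k) ℝ)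
    (r : Fin q → ℝ) (y : EuclideanSpace ℝ (Fin n)) : ℝ :=
  if (omegaHat w X R y).det ≠ 0 then
    (R *ᵥ betaHat X y - r) ⬝ᵥ ((omegaHat w X R y)⁻¹ *ᵥ (R *ᵥ betaHat X y - r))
  else 0

/-- The assumption on the weights. -/
def AssumptionAW (n : ℕ) (w : ℤ → ℝ) : Prop :=
  w 0 = 1 ∧ (∀ j : ℤ, |j| ≤ (n : ℤ) - 1 → w (-j) = w j) ∧
    (Matrix.of fun i j : Fin n => w (((i : ℕ) : ℤ) - ((j : ℕ) : ℤ))).PosDef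

/-- The matrix `B(y)`. -/
def Bmat {n k q : ℕ} (X : Matrix (Fin n) (Fin k) ℝ) (R : Matrix (Fin q) (Fin k) ℝ)
    (y : EuclideanSpace ℝ (Fin n)) : Matrix (Fin q) (Fin n) ℝ :=
  R * (Xᵀ * X)⁻¹ * Xᵀ * Matrix.diagonal (uHat X y)

/-- The set of all `y` with `rank B(y) < q`. -/
def Bset {n k q : ℕ} (X : Matrix (Fin n) (Fin k) ℝ) (R : Matrix (Fin q) (Fin k) ℝ) :
    Set (EuclideanSpace ℝ (Fin n)) :=
  {y | (Bmat X R y).rank < q}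

open Classical in
/-- The rank condition on `R (X'X)⁻¹ X'` after deletion of all columns of `X'` whose index `i` is
such that the standard basis vector `e_i` lies in the column space of `X`. -/
def AssumptionRX {n k q : ℕ} (X : Matrix (Fin n) (Fin k) ℝ) (R : Matrix (Fin q) (Fin k) ℝ) :
    Prop :=
  (R * (Xᵀ * X)⁻¹ * Xᵀ.submatrix id
    (Subtype.val : {i : Fin n // EuclideanSpace.single i (1 : ℝ) ∉ colSpan X} → Fin n)).rank = q

/-! ### Frequencies and the collection `S(F, L)` -/

/-- The `n × 2` matrix with `j`-th row `(j^s cos(jω), j^s sin(jω))`, `j = 1, …, n`. -/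
def E (n s : ℕ) (ω : ℝ) : Matrix (Fin n) (Fin 2) ℝ :=
  Matrix.of fun j =>
    ![((j : ℕ) + 1 : ℝ) ^ s * Real.cos (((j : ℕ) + 1 : ℝ) * ω),
      ((j : ℕ) + 1 : ℝ) ^ s * Real.sin (((j : ℕ) + 1 : ℝ) * ω)]

/-- The smallest `s` such that the column space of `E n s ω` is not contained in `L`. -/
def rho {n : ℕ} (ω : ℝ) (L : Submodule ℝ (EuclideanSpace ℝ (Fin n))) : ℕ :=
  sInf {s : ℕ | ¬ colSpan (E n s ω) ≤ L}

/-- The matrix `E_{n, ρ(γ, L)}(γ)`. -/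
def Erho {n : ℕ} (L : Submodule ℝ (EuclideanSpace ℝ (Fin n))) (γ : ℝ) :
    Matrix (Fin n) (Fin 2) ℝ :=
  E n (rho γ L) γ

/-- The block matrix `(E_{n, ρ(γ₁, L)}(γ₁), …, E_{n, ρ(γ_p, L)}(γ_p))`. -/
def Eblock {n p : ℕ} (L : Submodule ℝ (EuclideanSpace ℝ (Fin n))) (γ : Fin p → ℝ) :
    Matrix (Fin n) (Fin p × Fin 2) ℝ :=
  Matrix.of fun i c => Erho L (γ c.1) i c.2

open Classical in
def kappa (ω : ℝ) (d : ℕ) : ℕ :=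
  if ω = 0 ∨ ω = Real.pi then d else 2 * d

open Classical in
/-- The polynomial `Δ_ω`. -/
def Del (ω : ℝ) : Polynomial ℝ :=
  if ω = 0 ∨ ω = Real.pi then 1 - Polynomial.C (Real.cos ω) * Polynomial.X
  else 1 - Polynomial.C (2 * Real.cos ω) * Polynomial.X + Polynomial.X ^ 2

/-- The frequencies `ω ∈ [0, π]` with `ρ(ω, L) > 0`. This set is finite if `dim L < n`, so that the
sum and the product below are then ordinary finite ones. -/
def freqs {n : ℕ} (L : Submodule ℝ (EuclideanSpace ℝ (Fin n))) : Set ℝ :=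
  {ω | ω ∈ Set.Icc 0 Real.pi ∧ 0 < rho ω L}

/-- `κ(ω(L), d(L))`. -/
def kappaL {n : ℕ} (L : Submodule ℝ (EuclideanSpace ℝ (Fin n))) : ℕ :=
  ∑ᶠ ω ∈ freqs L, kappa ω (rho ω L)

/-- The polynomial `Δ_{ω(L), d(L)}`. -/
def DelL {n : ℕ} (L : Submodule ℝ (EuclideanSpace ℝ (Fin n))) : Polynomial ℝ :=
  ∏ᶠ ω ∈ freqs L, Del ω ^ rho ω L

/-- The function `ν ↦ |Δ_{ω(L), d(L)}(e^{iν})|² f(ν)`. -/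
def filtered {n : ℕ} (L : Submodule ℝ (EuclideanSpace ℝ (Fin n))) (f : ℝ → ℝ) (ν : ℝ) : ℝ :=
  ‖Polynomial.aeval (Complex.exp (Complex.I * (ν : ℂ))) (DelL L)‖ ^ 2 * f ν

/-- The spectral density obtained by normalizing `filtered L f`. -/
def gden {n : ℕ} (L : Submodule ℝ (EuclideanSpace ℝ (Fin n))) (f : ℝ → ℝ) (ν : ℝ) : ℝ :=
  filtered L f ν / ∫ ν' in Set.Icc (-Real.pi) Real.pi, filtered L f ν'

/-- The measure on `[-π, π]` (viewed as a measure on the real line) with Lebesgue density `g`. -/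
def specMeasure (g : ℝ → ℝ) : MeasureTheory.Measure ℝ :=
  (MeasureTheory.volume.restrict (Set.Icc (-Real.pi) Real.pi)).withDensity
    fun ν => ENNReal.ofReal (g ν)

/-- The collection `M(F, L)` of finite symmetric measures on `[-π, π]` (viewed as measures on the
real line that vanish outside of `[-π, π]`) with finite support that are weak limits of measures
with densities `gden L (f j)`, `f j ∈ F`, and that satisfy the bound on their support. -/
def MM {n : ℕ} (F : Set (ℝ → ℝ)) (L : Submodule ℝ (EuclideanSpace ℝ (Fin n))) :
    Set (MeasureTheory.FiniteMeasure ℝ) :=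
  {m | (m : MeasureTheory.Measure ℝ) (Set.Icc (-Real.pi) Real.pi)ᶜ = 0 ∧
    (∀ A : Set ℝ, MeasurableSet A →
      (m : MeasureTheory.Measure ℝ) ((fun x => -x) ⁻¹' A) = (m : MeasureTheory.Measure ℝ) A) ∧
    (m : MeasureTheory.Measure ℝ).support.Finite ∧
    (∃ (f : ℕ → ℝ → ℝ) (M : ℕ → MeasureTheory.FiniteMeasure ℝ), (∀ j, f j ∈ F) ∧
      (∀ j, (M j : MeasureTheory.Measure ℝ) = specMeasure (gden L (f j))) ∧
      Filter.Tendsto M Filter.atTop (nhds m)) ∧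
    (∑ᶠ γ ∈ (m : MeasureTheory.Measure ℝ).support ∩ Set.Icc 0 Real.pi, kappa γ 1) + kappaL L < n}

/-- The collection `S(F, L)`. -/
def SS {n : ℕ} (F : Set (ℝ → ℝ)) (L : Submodule ℝ (EuclideanSpace ℝ (Fin n))) : Set (Set ℝ) :=
  {Γ | ∃ m ∈ MM F L, Γ = (m : MeasureTheory.Measure ℝ).support ∩ Set.Icc 0 Real.pi}

/-! ### The bound `α*` -/

/-- The matrix of the orthogonal projection onto the orthogonal complement of `L`. -/
def projPerp {n : ℕ} (L : Submodule ℝ (EuclideanSpace ℝ (Fin n))) : Matrix (Fin n) (Fin n) ℝ :=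
  Matrix.of fun i j => (Lᗮ.starProjection (EuclideanSpace.single j (1 : ℝ))) i

/-- The Frobenius norm. -/
def frob {n : ℕ} (A : Matrix (Fin n) (Fin n) ℝ) : ℝ :=
  Real.sqrt (∑ i, ∑ j, A i j ^ 2)

/-- The normalized projected covariance matrix `L(Σ)`. -/
def normProj {n : ℕ} (L : Submodule ℝ (EuclideanSpace ℝ (Fin n)))
    (A : Matrix (Fin n) (Fin n) ℝ) : Matrix (Fin n) (Fin n) ℝ :=
  (frob (projPerp L * A * projPerp L))⁻¹ • (projPerp L * A * projPerp L)

/-- The collection `J(L, C)` for the covariance model `C`. -/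
def JJ {n : ℕ} (L : Submodule ℝ (EuclideanSpace ℝ (Fin n)))
    (C : Set (Matrix (Fin n) (Fin n) ℝ)) : Set (Submodule ℝ (EuclideanSpace ℝ (Fin n))) :=
  {S | ∃ A ∈ closure (normProj L '' C), A.rank + Module.finrank ℝ L < n ∧ S = colSpan A}

/-- Lebesgue measure on the affine space `μ + S`, viewed as a measure on the whole space. -/
def lebAffine {n : ℕ} (μ : EuclideanSpace ℝ (Fin n))
    (S : Submodule ℝ (EuclideanSpace ℝ (Fin n))) :
    MeasureTheory.Measure (EuclideanSpace ℝ (Fin n)) :=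
  ((stdOrthonormalBasis ℝ S).toBasis.addHaar).map
    (fun s : S => μ + (s : EuclideanSpace ℝ (Fin n)))

/-- `C*`: the supremum of the constants `C(S)` over all `S ∈ J(L, C(F))` such that `T` equals the
constant `C(S)` almost everywhere on `μ₀ + S` for some `μ₀ ∈ M₀`; it is `-∞` if there are none. -/
def Cstar {n : ℕ} (M₀ : Set (EuclideanSpace ℝ (Fin n)))
    (L : Submodule ℝ (EuclideanSpace ℝ (Fin n))) (F : Set (ℝ → ℝ))
    (T : EuclideanSpace ℝ (Fin n) → ℝ) : EReal :=
  sSup {x : EReal | ∃ S ∈ JJ L (Sig n '' F), ∃ c : ℝ, x = (c : EReal) ∧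
    ∃ μ₀ ∈ M₀, ∀ᵐ y ∂(lebAffine μ₀ S), T y = c}

/-- `α*`: the supremum of the sizes of the tests with critical value larger than `C*`. -/
def alphaStar {n : ℕ} (M₀ : Set (EuclideanSpace ℝ (Fin n)))
    (L : Submodule ℝ (EuclideanSpace ℝ (Fin n))) (F : Set (ℝ → ℝ))
    (T : EuclideanSpace ℝ (Fin n) → ℝ) : ENNReal :=
  ⨆ (C : ℝ) (_ : Cstar M₀ L F T < (C : EReal)), size M₀ F T C

end

end SizeControl

namespace SizeControl
open Polynomial

/-! ### Polynomials attached to observations -/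

/-! Write `L` for `M0lin X R`. The statistic is unchanged, up to replacing `r` by zero, when an
element of `M0 X R r` is removed, and it is then invariant under translation by `L` and under
nonzero scaling. Rejection probabilities therefore depend on the covariance matrix only through its
normalized projection, and `size_eq_iSup_roots` writes the size as a supremum of standard Gaussian
probabilities of `C ≤ T(Gz)`, with `G` a root of such a projection. The roots form a bounded set, so
any sequence of them has a convergent subsequence. The crux is `exists_limit_root`: at a limit root
`G'` the statistic is almost surely continuous at `G'z`. The denominator `denom` is polynomial and
nonzero off `Bset X R`, so one point of `colSpan G' ⊔ L` outside `Bset X R` is enough. If `A =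
G'G'ᵀ` is nonsingular on `Lᗮ`, that sum is the whole space and `exists_notMem_Bset` supplies the
point. If `A` is singular there, `exists_mem_SS_colSpan_le` shows that the sum contains the
trigonometric vectors of some `Γ` in `SS F L`, and the avoidance condition supplies the point. The
singular case rests on polynomial algebra. The quadratic form of `Sig n f` at `x` integrates `|p|²
f` over the unit circle, where `p = obsPoly x`. For `x` in `Lᗮ`, `DelL L` divides `p`, so the form
is a scalar independent of `x` times the integral of the squared quotient against the measure with
density `gden L f`. A weak limit of these measures thus determines the limit form up to a nonzero
scalar. A null vector of that form makes the quotient vanish on the support, which is therefore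
finite and obeys the degree bound in `MM`; one further zero of the quotient at `γ` is orthogonality
to `Erho L γ`. Given continuity at limits, the size gets below any positive level, and it is left
continuous above `Cstar`. It is always right continuous, since no single root gives the statistic an
atom. Attainment of a prescribed size follows by monotonicity. -/

/-- The operator `p ↦ (X p)'`. -/
noncomputable def shiftDeriv : Module.End ℝ ℝ[X] := derivative ∘ₗ LinearMap.mulLeft ℝ X

theorem shiftDeriv_apply (p : ℝ[X]) : shiftDeriv p = p + X * derivative p := by
  simp [shiftDeriv, derivative_mul]

/-- Monomials are eigenvectors of `shiftDeriv` with eigenvalue `j + 1`; this produces the weights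
`(j + 1)^s` in the rows of `E n s ω`. -/
theorem shiftDeriv_pow_monomial (s j : ℕ) (a : ℝ) :
    (shiftDeriv ^ s) (C a * X ^ j) = C (((j : ℝ) + 1) ^ s * a) * X ^ j := by
  induction s with
  | zero => simp
  | succ s ih =>
    rw [pow_succ', Module.End.mul_apply, ih, shiftDeriv_apply, derivative_C_mul_X_pow]
    rcases j with _ | j
    · simp
    · simp only [Nat.add_sub_cancel, map_mul, map_pow, map_add, map_natCast, map_one]
      ring

/-- Repeated application of `shiftDeriv` to a multiple of a power of a polynomial with a root. -/
theorem aeval_shiftDeriv_pow {P : ℝ[X]} {z : ℂ} (hz : aeval z P = 0) (m : ℕ) (q : ℝ[X]) :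
    aeval z ((shiftDeriv ^ m) (P ^ m * q)) =
      m.factorial * (z * aeval z (derivative P)) ^ m * aeval z q := by
  induction m generalizing q with
  | zero => simp
  | succ m ih =>
    -- One application lowers the exponent of `P` by one; at the root only the term that
    -- differentiates `P` survives.
    have h : shiftDeriv (P ^ (m + 1) * q) =
        P ^ m * (C ((m : ℝ) + 1) * X * derivative P * q + P * (q + X * derivative q)) := by
      rw [shiftDeriv_apply, derivative_mul, derivative_pow]
      simp only [Nat.add_sub_cancel, map_add, map_natCast, map_one, Nat.cast_add, Nat.cast_one]
      ring
    rw [pow_succ, Module.End.mul_apply, h, ih]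
    simp only [map_add, map_mul, hz, aeval_X, aeval_C, Nat.factorial_succ]
    push_cast
    simp
    ring

/-- Once `P ^ m` divides `p`, the value of order `m` is a nonzero multiple of the cofactor at `z`,
because `z` is a nonzero simple root of `P`. It vanishes exactly when a further `P` splits off. -/
theorem pow_dvd_iff_aeval_shiftDeriv {P : ℝ[X]} {z : ℂ} (hz0 : z ≠ 0)
    (hP : ∀ q : ℝ[X], P ∣ q ↔ aeval z q = 0) (hP' : aeval z (derivative P) ≠ 0)
    (m : ℕ) (p : ℝ[X]) :
    P ^ m ∣ p ↔ ∀ s < m, aeval z ((shiftDeriv ^ s) p) = 0 := by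
  have hz : aeval z P = 0 := (hP P).1 dvd_rfl
  constructor
  · rintro ⟨q, rfl⟩ s hs
    obtain ⟨d, rfl⟩ : ∃ d, m = s + (d + 1) := ⟨m - s - 1, by omega⟩
    rw [pow_add, mul_assoc, aeval_shiftDeriv_pow hz]
    simp [hz]
  · intro h
    induction m with
    | zero => simp
    | succ m ih =>
      obtain ⟨q, rfl⟩ := ih fun s hs => h s (by omega)
      have h1 := h m (by omega)
      rw [aeval_shiftDeriv_pow hz] at h1
      have h2 : aeval z q = 0 := by
        rcases mul_eq_zero.1 h1 with h3 | h3
        · exact absurd h3 (mul_ne_zero (by exact_mod_cast m.factorial_ne_zero)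
            (pow_ne_zero _ (mul_ne_zero hz0 hP')))
        · exact h3
      rw [pow_succ]
      exact mul_dvd_mul_left _ ((hP q).2 h2)

/-! ### The unit circle and the factors `Del ω`. -/

/-- The point `e^{iω}` of the unit circle. -/
noncomputable def circ (ω : ℝ) : ℂ := Complex.exp (Complex.I * (ω : ℂ))

theorem circ_eq (ω : ℝ) : circ ω = ⟨Real.cos ω, Real.sin ω⟩ := by
  rw [circ, mul_comm, Complex.exp_mul_I, ← Complex.ofReal_cos, ← Complex.ofReal_sin]
  apply Complex.ext <;> simp [-Complex.ofReal_cos, -Complex.ofReal_sin]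

theorem circ_ne_zero (ω : ℝ) : circ ω ≠ 0 := Complex.exp_ne_zero _

theorem circ_pow (ω : ℝ) (m : ℕ) : circ ω ^ m = circ (m * ω) := by
  rw [circ, circ, ← Complex.exp_nat_mul]
  push_cast
  ring_nf

theorem continuous_circ : Continuous circ := by
  unfold circ; fun_prop

theorem sq_cos_eq_one_of_endpoint {ω : ℝ} (h : ω = 0 ∨ ω = Real.pi) :
    Real.cos ω ^ 2 = 1 ∧ Real.sin ω = 0 := by
  rcases h with rfl | rfl <;> simp

theorem sin_pos_of_not_endpoint {ω : ℝ} (hω : ω ∈ Set.Icc 0 Real.pi)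
    (h : ¬ (ω = 0 ∨ ω = Real.pi)) : 0 < Real.sin ω := by
  push Not at h
  exact Real.sin_pos_of_pos_of_lt_pi (lt_of_le_of_ne hω.1 h.1.symm) (lt_of_le_of_ne hω.2 h.2)

/-- At an endpoint `cos ω ^ 2 = 1`, so `Del ω` is a unit times `X - cos ω`. Otherwise it is monic
quadratic with the nonreal root `circ ω`, and a real remainder of degree at most one vanishing at a
nonreal point is zero. -/
theorem Del_dvd_iff {ω : ℝ} (hω : ω ∈ Set.Icc 0 Real.pi) (p : ℝ[X]) :
    Del ω ∣ p ↔ aeval (circ ω) p = 0 := by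
  by_cases h : ω = 0 ∨ ω = Real.pi
  · obtain ⟨hc, hs⟩ := sq_cos_eq_one_of_endpoint h
    have h1 : Del ω = C (-Real.cos ω) * (X - C (Real.cos ω)) := by
      rw [Del, if_pos h, mul_sub, ← C_mul, neg_mul, ← sq, hc]
      simp; ring
    have hu : IsUnit (C (-Real.cos ω) : ℝ[X]) := by
      rw [isUnit_C, isUnit_iff_ne_zero]
      intro h0
      rw [neg_eq_zero] at h0
      simp [h0] at hc
    have h2 : circ ω = ((Real.cos ω : ℝ) : ℂ) := by
      rw [circ_eq, hs]; rfl
    rw [h1, hu.mul_left_dvd, dvd_iff_isRoot, h2, IsRoot.def]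
    rw [show ((Real.cos ω : ℝ) : ℂ) = algebraMap ℝ ℂ (Real.cos ω) from rfl,
      aeval_algebraMap_apply]
    simp
  · have hs := sin_pos_of_not_endpoint hω h
    have hD : Del ω = X ^ 2 + (C (-(2 * Real.cos ω)) * X + C 1) := by
      rw [Del, if_neg h]; simp; ring
    have hm : (Del ω).Monic := by
      rw [hD]
      exact monic_X_pow_add (degree_linear_lt_degree_C_mul_X_sq (a := (1:ℝ)) one_ne_zero |>.trans_le
        (by simp))
    have hz : aeval (circ ω) (Del ω) = 0 := by
      rw [hD, circ_eq]
      simp only [map_add, map_pow, map_mul, aeval_X, aeval_C]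
      have := Real.sin_sq_add_cos_sq ω
      apply Complex.ext
      · simp [sq, -Complex.ofReal_cos]; nlinarith
      · simp [sq, -Complex.ofReal_cos]; ring
    constructor
    · rintro ⟨q, rfl⟩; simp [hz]
    · intro hp
      have h1 := modByMonic_add_div p (Del ω)
      have hdeg : (Del ω).degree = 2 := by
        rw [hD]; compute_degree!
      have h2 : (p %ₘ Del ω).degree < 2 := hdeg ▸ degree_modByMonic_lt p hm
      have h3 : aeval (circ ω) (p %ₘ Del ω) = 0 := by
        rw [← h1] at hp
        simpa [hz] using hp
      have h4 : (p %ₘ Del ω).degree ≤ 1 := Order.le_of_lt_succ h2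
      rw [eq_X_add_C_of_degree_le_one h4, circ_eq] at h3
      have h5 := congrArg Complex.im h3
      have h6 := congrArg Complex.re h3
      simp [hs.ne'] at h5
      simp [h5] at h6
      rw [← h1, eq_X_add_C_of_degree_le_one h4, h5, h6]
      simp

/-- The root is simple: the derivative is `-cos ω` at an endpoint, and has imaginary part `2 sin ω`
at an interior frequency. -/
theorem aeval_circ_derivative_Del {ω : ℝ} (hω : ω ∈ Set.Icc 0 Real.pi) :
    aeval (circ ω) (derivative (Del ω)) ≠ 0 := by
  rw [circ_eq, Del]
  split_ifs with h
  · obtain ⟨hc, hs⟩ := sq_cos_eq_one_of_endpoint h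
    intro h0
    have h5 := congrArg Complex.re h0
    simp [-Complex.ofReal_cos] at h5
    simp [h5] at hc
  · have hs := sin_pos_of_not_endpoint hω h
    intro h0
    have h5 := congrArg Complex.im h0
    simp [derivative_mul, hs.ne'] at h5

theorem Del_ne_zero (ω : ℝ) : Del ω ≠ 0 := by
  intro h
  have h1 := congrArg (fun p => coeff p 0) h
  rw [Del] at h1
  split_ifs at h1 <;> simp at h1

theorem cos_eq_of_aeval_Del_eq_zero {ω γ : ℝ} (h : aeval (circ γ) (Del ω) = 0) :
    Real.cos γ = Real.cos ω := by
  rw [circ_eq, Del] at h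
  split_ifs at h with h1
  · obtain ⟨hc, -⟩ := sq_cos_eq_one_of_endpoint h1
    have h5 := congrArg Complex.re h
    simp [-Complex.ofReal_cos] at h5
    linear_combination -Real.cos γ * hc - Real.cos ω * h5
  · have h5 := congrArg Complex.re h
    have h6 := congrArg Complex.im h
    simp [sq, -Complex.ofReal_cos] at h5 h6
    have h7 := Real.sin_sq_add_cos_sq γ
    by_cases hs : Real.sin γ = 0
    · have h8 : Real.cos γ * (Real.cos γ - Real.cos ω) = 0 := by nlinarith
      rcases mul_eq_zero.1 h8 with h9 | h9
      · simp [hs, h9] at h7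
      · linarith
    · have h8 : Real.sin γ * (Real.cos γ - Real.cos ω) = 0 := by nlinarith
      rcases mul_eq_zero.1 h8 with h9 | h9
      · exact absurd h9 hs
      · linarith

/-- The multiples of `Del ω` are the kernel of an evaluation into the field `ℂ`. -/
theorem Del_prime {ω : ℝ} (hω : ω ∈ Set.Icc 0 Real.pi) : Prime (Del ω) := by
  refine ⟨Del_ne_zero ω, ?_, ?_⟩
  · intro hu
    have h := (Del_dvd_iff hω 1).1 hu.dvd
    simp at h
  · intro a b
    simp only [Del_dvd_iff hω, map_mul, mul_eq_zero, imp_self]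

theorem Del_isCoprime {ω γ : ℝ} (hω : ω ∈ Set.Icc 0 Real.pi) (hγ : γ ∈ Set.Icc 0 Real.pi)
    (h : ω ≠ γ) : IsCoprime (Del ω) (Del γ) := by
  rw [(Del_prime hω).irreducible.coprime_iff_not_dvd, Del_dvd_iff hω]
  intro h0
  exact h (Real.injOn_cos hω hγ (cos_eq_of_aeval_Del_eq_zero h0))

theorem natDegree_Del_pow (ω : ℝ) (d : ℕ) : (Del ω ^ d).natDegree = kappa ω d := by
  rw [natDegree_pow, Del, kappa]
  split_ifs with h
  · obtain ⟨hc, -⟩ := sq_cos_eq_one_of_endpoint h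
    have : Real.cos ω ≠ 0 := by rintro h0; simp [h0] at hc
    have : (1 - C (Real.cos ω) * X).natDegree = 1 := by
      compute_degree!
    rw [this, mul_one]
  · have : (1 - C (2 * Real.cos ω) * X + X ^ 2).natDegree = 2 := by
      compute_degree!
    rw [this, mul_comm]

theorem Del_pow_dvd_iff {ω : ℝ} (hω : ω ∈ Set.Icc 0 Real.pi) (m : ℕ) (p : ℝ[X]) :
    Del ω ^ m ∣ p ↔ ∀ s < m, aeval (circ ω) ((shiftDeriv ^ s) p) = 0 :=
  pow_dvd_iff_aeval_shiftDeriv (circ_ne_zero ω) (Del_dvd_iff hω)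
    (aeval_circ_derivative_Del hω) m p

variable {n : ℕ}

/-- The polynomial `∑ⱼ xⱼ Xʲ`, `j = 0, …, n - 1`. -/
noncomputable def obsPoly (x : EuclideanSpace ℝ (Fin n)) : ℝ[X] := ∑ j, C (x j) * X ^ (j : ℕ)

theorem coeff_obsPoly (x : EuclideanSpace ℝ (Fin n)) (j : Fin n) :
    (obsPoly x).coeff j = x j := by
  simp [obsPoly, coeff_C_mul, coeff_X_pow, Fin.val_inj]

theorem obsPoly_ne_zero {x : EuclideanSpace ℝ (Fin n)} (hx : x ≠ 0) : obsPoly x ≠ 0 := by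
  intro h
  apply hx
  ext j
  rw [← coeff_obsPoly, h]; simp

theorem natDegree_obsPoly_lt {x : EuclideanSpace ℝ (Fin n)} (hx : x ≠ 0) :
    (obsPoly x).natDegree < n := by
  rw [natDegree_lt_iff_degree_lt (obsPoly_ne_zero hx)]
  refine degree_sum_fin_lt _

theorem aeval_shiftDeriv_obsPoly (x : EuclideanSpace ℝ (Fin n)) (s : ℕ) (z : ℂ) :
    aeval z ((shiftDeriv ^ s) (obsPoly x)) = ∑ j : Fin n, ((j : ℂ) + 1) ^ s * x j * z ^ (j : ℕ) := by
  simp [obsPoly, shiftDeriv_pow_monomial]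

/-- Orthogonality to the column space of `E n s ω` in terms of `obsPoly`. -/
theorem forall_colSpan_E_inner_eq_zero_iff (x : EuclideanSpace ℝ (Fin n)) (s : ℕ) (ω : ℝ) :
    (∀ v ∈ colSpan (E n s ω), inner ℝ v x = 0) ↔
      aeval (circ ω) ((shiftDeriv ^ s) (obsPoly x)) = 0 := by
  have h1 : (∀ v ∈ colSpan (E n s ω), inner ℝ v x = 0) ↔
      (∑ j : Fin n, x j * (((j : ℕ) + 1 : ℝ) ^ s * Real.cos (((j : ℕ) + 1 : ℝ) * ω)) = 0 ∧
       ∑ j : Fin n, x j * (((j : ℕ) + 1 : ℝ) ^ s * Real.sin (((j : ℕ) + 1 : ℝ) * ω)) = 0) := by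
    have : (∀ v ∈ colSpan (E n s ω), inner ℝ v x = 0) ↔ colSpan (E n s ω) ≤ (ℝ ∙ x)ᗮ := by
      simp only [SetLike.le_def, Submodule.mem_orthogonal_singleton_iff_inner_left]
    rw [this, colSpan, Submodule.span_le]
    simp only [Set.range_subset_iff, SetLike.mem_coe,
      Submodule.mem_orthogonal_singleton_iff_inner_left, Fin.forall_fin_two, PiLp.inner_apply]
    simp [E]
  -- The exponents of `obsPoly` start at zero and the rows of `E` at one; the nonzero factor `circ
  -- ω` makes up for the shift.
  have h2 : circ ω * aeval (circ ω) ((shiftDeriv ^ s) (obsPoly x)) =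
      ⟨∑ j : Fin n, x j * (((j : ℕ) + 1 : ℝ) ^ s * Real.cos (((j : ℕ) + 1 : ℝ) * ω)),
       ∑ j : Fin n, x j * (((j : ℕ) + 1 : ℝ) ^ s * Real.sin (((j : ℕ) + 1 : ℝ) * ω))⟩ := by
    rw [aeval_shiftDeriv_obsPoly, Finset.mul_sum]
    have h3 : ∀ j : Fin n, circ ω * (((j : ℂ) + 1) ^ s * x j * circ ω ^ (j : ℕ)) =
        ⟨x j * (((j : ℕ) + 1 : ℝ) ^ s * Real.cos (((j : ℕ) + 1 : ℝ) * ω)),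
         x j * (((j : ℕ) + 1 : ℝ) ^ s * Real.sin (((j : ℕ) + 1 : ℝ) * ω))⟩ := by
      intro j
      have h4 : circ ω * (((j : ℂ) + 1) ^ s * x j * circ ω ^ (j : ℕ)) =
          ((x j * ((j : ℕ) + 1 : ℝ) ^ s : ℝ) : ℂ) * circ ω ^ ((j : ℕ) + 1) := by
        push_cast; ring
      rw [h4, circ_pow, circ_eq]
      apply Complex.ext
      · rw [Complex.re_ofReal_mul]; push_cast; ring
      · rw [Complex.im_ofReal_mul]; push_cast; ring
    rw [Finset.sum_congr rfl fun j _ => h3 j]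
    apply Complex.ext <;> simp [Complex.re_sum, Complex.im_sum]
  rw [h1]
  have h3 : aeval (circ ω) ((shiftDeriv ^ s) (obsPoly x)) = 0 ↔
      circ ω * aeval (circ ω) ((shiftDeriv ^ s) (obsPoly x)) = 0 := by
    simp [circ_ne_zero]
  rw [h3, h2, Complex.ext_iff]
  simp

end SizeControl

namespace SizeControl
open MeasureTheory Polynomial

/-! ### Zero sets of polynomial functions -/

/-- The continuous functions on `E` that are polynomial along each line. -/
def polyFun (E : Type*) [NormedAddCommGroup E] [NormedSpace ℝ E] : Subalgebra ℝ (E → ℝ) where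
  carrier := {f | Continuous f ∧ ∀ a v : E, ∃ p : ℝ[X], ∀ t : ℝ, f (a + t • v) = p.eval t}
  mul_mem' := by
    rintro f g ⟨hf, hf'⟩ ⟨hg, hg'⟩
    refine ⟨hf.mul hg, fun a v => ?_⟩
    obtain ⟨p, hp⟩ := hf' a v
    obtain ⟨p', hp'⟩ := hg' a v
    exact ⟨p * p', fun t => by simp [hp, hp']⟩
  add_mem' := by
    rintro f g ⟨hf, hf'⟩ ⟨hg, hg'⟩
    refine ⟨hf.add hg, fun a v => ?_⟩
    obtain ⟨p, hp⟩ := hf' a v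
    obtain ⟨p', hp'⟩ := hg' a v
    exact ⟨p + p', fun t => by simp [hp, hp']⟩
  algebraMap_mem' c := ⟨continuous_const, fun _ _ => ⟨C c, fun t => by simp⟩⟩

section

variable {E : Type*} [NormedAddCommGroup E] [NormedSpace ℝ E]

theorem polyFun_linear [FiniteDimensional ℝ E] (l : E →ₗ[ℝ] ℝ) : (l : E → ℝ) ∈ polyFun E :=
  ⟨l.continuous_of_finiteDimensional, fun a v => ⟨C (l a) + C (l v) * X, fun t => by
    rw [map_add, map_smul, smul_eq_mul, eval_add, eval_mul, eval_C, eval_C, eval_X, mul_comm]⟩⟩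

theorem polyFun_comp_affine {E' : Type*} [NormedAddCommGroup E'] [NormedSpace ℝ E']
    [FiniteDimensional ℝ E'] {f : E → ℝ} (hf : f ∈ polyFun E) (b : E) (g : E' →ₗ[ℝ] E) :
    (fun x => f (b + g x)) ∈ polyFun E' := by
  refine ⟨hf.1.comp (continuous_const.add g.continuous_of_finiteDimensional), fun a v => ?_⟩
  obtain ⟨p, hp⟩ := hf.2 (b + g a) (g v)
  exact ⟨p, fun t => by rw [← hp]; simp [add_assoc]⟩

theorem polyFun_det {m : Type*} [Fintype m] [DecidableEq m] {M : E → Matrix m m ℝ}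
    (hM : ∀ i j, (fun x => M x i j) ∈ polyFun E) : (fun x => (M x).det) ∈ polyFun E := by
  have : (fun x => (M x).det) =
      ∑ σ : Equiv.Perm m, ((Equiv.Perm.sign σ : ℤ) : ℝ) • ∏ i, fun x => M x (σ i) i := by
    ext x
    simp [Matrix.det_apply', Finset.sum_apply, Finset.prod_apply]
  rw [this]
  exact sum_mem fun σ _ => Subalgebra.smul_mem _ (prod_mem fun i _ => hM _ _) _

theorem polyFun_adjugate {m : Type*} [Fintype m] [DecidableEq m] {M : E → Matrix m m ℝ}
    (hM : ∀ i j, (fun x => M x i j) ∈ polyFun E) (i j : m) :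
    (fun x => (M x).adjugate i j) ∈ polyFun E := by
  simp only [Matrix.adjugate_apply]
  refine polyFun_det fun a b => ?_
  by_cases h : a = j
  · subst h
    simp only [Matrix.updateRow_self]
    exact Subalgebra.algebraMap_mem _ _
  · simp only [Matrix.updateRow_ne h]
    exact hM a b

variable [FiniteDimensional ℝ E] [MeasurableSpace E] [BorelSpace E]

/-- The zero set of a nonzero polynomial function is a null set. -/
theorem polyFun_ae_ne_zero {f : E → ℝ} (hf : f ∈ polyFun E) {a : E} (ha : f a ≠ 0)
    (μ : Measure E) [μ.IsAddHaarMeasure] : ∀ᵐ x ∂μ, f x ≠ 0 := by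
  obtain ⟨hc, hp⟩ := hf
  set g : E → ℝ := fun y => f (a + y) with hg
  have hgc : Continuous g := hc.comp (continuous_const.add continuous_id)
  set Z : Set E := {y | g y = 0} with hZ
  have hZm : MeasurableSet Z := (isClosed_eq hgc continuous_const).measurableSet
  suffices h : μ Z = 0 by
    have h1 : μ {x | f x = 0} = 0 := by
      have : (fun y => a + y) ⁻¹' {x | f x = 0} = Z := rfl
      rw [← measure_preimage_add μ a, this, h]
    simpa [ae_iff] using h1
  -- Fubini: for fixed `y`, the polynomial `t ↦ f (a + t • y)` is nonzero at `t = 0`, so it has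
  -- finitely many roots.
  have hint : ∫⁻ t in Set.Icc (1 : ℝ) 2, μ ((fun y => t • y) ⁻¹' Z) = 0 := by
    have hm : MeasurableSet {q : ℝ × E | g (q.1 • q.2) = 0} :=
      (isClosed_eq (hgc.comp (continuous_fst.smul continuous_snd)) continuous_const).measurableSet
    have h1 : ((volume.restrict (Set.Icc (1 : ℝ) 2)).prod μ) {q : ℝ × E | g (q.1 • q.2) = 0} = 0 := by
      rw [Measure.prod_apply_symm hm]
      refine (lintegral_congr fun y => ?_).trans lintegral_zero
      obtain ⟨p, hp⟩ := hp a y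
      have hp0 : p ≠ 0 := by
        rintro rfl
        apply ha
        simpa using hp 0
      refine Set.Finite.measure_zero (Set.Finite.subset p.roots.toFinset.finite_toSet ?_) _
      intro t ht
      simp only [Set.mem_preimage, Set.mem_ofPred_eq, hg] at ht
      simp [hp0, ← hp, ht]
    rw [Measure.prod_apply hm] at h1
    exact h1
  -- Dilation by `t ≤ 2` changes Haar measure by a factor bounded below, so a null integral forces
  -- `Z` itself to be null.
  have hd : ∀ t ∈ Set.Icc (1 : ℝ) 2,
      ENNReal.ofReal (|(2 ^ Module.finrank ℝ E)⁻¹|) * μ Z ≤ μ ((fun y => t • y) ⁻¹' Z) := by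
    intro t ht
    have ht0 : (0 : ℝ) < t := by linarith [ht.1]
    rw [Measure.addHaar_preimage_smul μ ht0.ne']
    gcongr
    exact ht.2
  have h2 := setLIntegral_mono' (μ := volume) measurableSet_Icc hd
  rw [hint] at h2
  simpa using h2

end

/-! ### Null sets of the standard Gaussian distribution. -/

theorem pi_absolutelyContinuous (n : ℕ) {μ ν : Measure ℝ} [SigmaFinite μ] [SigmaFinite ν]
    (h : μ ≪ ν) : (Measure.pi fun _ : Fin n => μ) ≪ Measure.pi fun _ : Fin n => ν := by
  induction n with
  | zero =>
    rw [Measure.pi_of_empty, Measure.pi_of_empty]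
  | succ n ih =>
    have h1 := (measurePreserving_piFinSuccAbove (fun _ : Fin (n + 1) => μ) 0).symm
    have h2 := (measurePreserving_piFinSuccAbove (fun _ : Fin (n + 1) => ν) 0).symm
    rw [← h1.map_eq, ← h2.map_eq]
    exact (h.prod ih).map (MeasurableEquiv.measurable _)

theorem stdGaussian_absolutelyContinuous (n : ℕ) :
    ProbabilityTheory.stdGaussian (EuclideanSpace ℝ (Fin n)) ≪ volume := by
  rw [← ProbabilityTheory.map_pi_eq_stdGaussian,
    ← (PiLp.volume_preserving_toLp (Fin n)).map_eq]
  exact (pi_absolutelyContinuous n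
    (ProbabilityTheory.gaussianReal_absolutelyContinuous 0 one_ne_zero)).map
      (WithLp.measurable_toLp 2 _)

theorem polyFun_ae_stdGaussian_ne_zero {n : ℕ} {f : EuclideanSpace ℝ (Fin n) → ℝ}
    (hf : f ∈ polyFun _) {a : EuclideanSpace ℝ (Fin n)} (ha : f a ≠ 0) :
    ∀ᵐ x ∂ProbabilityTheory.stdGaussian (EuclideanSpace ℝ (Fin n)), f x ≠ 0 :=
  (stdGaussian_absolutelyContinuous n).ae_le (polyFun_ae_ne_zero hf ha volume)

end SizeControl

namespace SizeControl
open MeasureTheory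

/-! ### The test statistic as a quotient of polynomial functions -/

theorem rank_eq_card_iff_mulVec {m m' : Type*} [Fintype m] [Fintype m'] (A : Matrix m m' ℝ) :
    A.rank = Fintype.card m' ↔ ∀ v, A *ᵥ v = 0 → v = 0 := by
  have h := A.mulVecLin.finrank_range_add_finrank_ker
  rw [Module.finrank_fintype_fun_eq_card] at h
  have h1 : (∀ v, A *ᵥ v = 0 → v = 0) ↔ LinearMap.ker A.mulVecLin = ⊥ := by
    rw [LinearMap.ker_eq_bot']; rfl
  rw [h1, ← Submodule.finrank_eq_zero (R := ℝ), Matrix.rank]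
  omega

theorem rank_eq_card_iff_vecMul {m m' : Type*} [Fintype m] [Fintype m'] (A : Matrix m m' ℝ) :
    A.rank = Fintype.card m ↔ ∀ v, v ᵥ* A = 0 → v = 0 := by
  rw [← Matrix.rank_transpose, rank_eq_card_iff_mulVec]
  simp only [Matrix.mulVec_transpose]

variable {n k q : ℕ} {X : Matrix (Fin n) (Fin k) ℝ} {R : Matrix (Fin q) (Fin k) ℝ}
  {r : Fin q → ℝ} {w : ℤ → ℝ}

theorem isUnit_det_gram (hX : X.rank = k) : IsUnit (Xᵀ * X).det := by
  rw [← Matrix.isUnit_iff_isUnit_det, ← Matrix.mulVec_injective_iff_isUnit]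
  have h : (Xᵀ * X).rank = Fintype.card (Fin k) := by
    rw [Matrix.rank_transpose_mul_self, hX, Fintype.card_fin]
  rw [rank_eq_card_iff_mulVec] at h
  intro a b hab
  rw [← sub_eq_zero]
  apply h
  rw [Matrix.mulVec_sub, sub_eq_zero]
  exact hab

/-- The ordinary least squares estimator as a linear map. -/
noncomputable def betaHatLin (X : Matrix (Fin n) (Fin k) ℝ) :
    EuclideanSpace ℝ (Fin n) →ₗ[ℝ] (Fin k → ℝ) :=
  ((Xᵀ * X)⁻¹ * Xᵀ).mulVecLin ∘ₗ (WithLp.linearEquiv 2 ℝ (Fin n → ℝ)).toLinearMap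

theorem betaHatLin_apply (y : EuclideanSpace ℝ (Fin n)) : betaHatLin X y = betaHat X y := rfl

/-- The ordinary least squares residuals as a linear map. -/
noncomputable def uHatLin (X : Matrix (Fin n) (Fin k) ℝ) :
    EuclideanSpace ℝ (Fin n) →ₗ[ℝ] (Fin n → ℝ) :=
  (WithLp.linearEquiv 2 ℝ (Fin n → ℝ)).toLinearMap - X.mulVecLin ∘ₗ betaHatLin X

theorem uHatLin_apply (y : EuclideanSpace ℝ (Fin n)) : uHatLin X y = uHat X y := rfl

theorem betaHat_toLp (hX : X.rank = k) (β : Fin k → ℝ) :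
    betaHat X (WithLp.toLp 2 (X *ᵥ β)) = β := by
  simp only [betaHat, Matrix.mulVec_mulVec, Matrix.mul_assoc]
  rw [Matrix.nonsing_inv_mul _ (isUnit_det_gram hX), Matrix.one_mulVec]

theorem uHat_toLp (hX : X.rank = k) (β : Fin k → ℝ) :
    uHat X (WithLp.toLp 2 (X *ᵥ β)) = 0 := by
  rw [uHat, betaHat_toLp hX, sub_self]

theorem mem_colSpan_iff {m : Type} [Fintype m] {A : Matrix (Fin n) m ℝ}
    {y : EuclideanSpace ℝ (Fin n)} : y ∈ colSpan A ↔ ∃ β : m → ℝ, y = WithLp.toLp 2 (A *ᵥ β) := by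
  rw [colSpan, Submodule.mem_span_range_iff_exists_fun]
  refine exists_congr fun β => ?_
  have : ∑ j, β j • WithLp.toLp 2 (fun i => A i j) = WithLp.toLp 2 (A *ᵥ β) := by
    ext i
    simp [Matrix.mulVec, dotProduct, mul_comm]
  rw [this, eq_comm]

theorem uHat_of_mem_colSpan (hX : X.rank = k) {y : EuclideanSpace ℝ (Fin n)}
    (hy : y ∈ colSpan X) : uHat X y = 0 := by
  obtain ⟨β, rfl⟩ := mem_colSpan_iff.1 hy
  exact uHat_toLp hX β

theorem uHat_add_of_mem_colSpan (hX : X.rank = k) (y : EuclideanSpace ℝ (Fin n))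
    {v : EuclideanSpace ℝ (Fin n)} (hv : v ∈ colSpan X) : uHat X (y + v) = uHat X y := by
  rw [← uHatLin_apply, map_add, uHatLin_apply, uHatLin_apply, uHat_of_mem_colSpan hX hv, add_zero]

theorem uHat_of_mem_orthogonal {u : EuclideanSpace ℝ (Fin n)} (hu : u ∈ (colSpan X)ᗮ) :
    uHat X u = u.ofLp := by
  have : Xᵀ *ᵥ u.ofLp = 0 := by
    ext j
    have h1 := hu _ (Submodule.subset_span ⟨j, rfl⟩)
    simpa [PiLp.inner_apply, Matrix.mulVec, dotProduct, mul_comm] using h1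
  rw [uHat, betaHat, ← Matrix.mulVec_mulVec, this]
  simp

theorem M0lin_le_colSpan : M0lin X R ≤ colSpan X := by
  rintro _ ⟨β, rfl, -⟩
  exact mem_colSpan_iff.2 ⟨β, rfl⟩

/-- The Toeplitz matrix of the weights. -/
def weightMat (n : ℕ) (w : ℤ → ℝ) : Matrix (Fin n) (Fin n) ℝ :=
  Matrix.of fun i j : Fin n => w (((i : ℕ) : ℤ) - ((j : ℕ) : ℤ))

theorem gammaHat_eq (y : EuclideanSpace ℝ (Fin n)) (j : ℤ) :
    gammaHat X y j = (n : ℝ)⁻¹ • ∑ t : Fin n, ∑ s : Fin n,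
      if ((t : ℕ) : ℤ) - ((s : ℕ) : ℤ) = j then
        Matrix.vecMulVec (vHat X y t) (vHat X y s) else 0 := by
  unfold gammaHat gammaHatNat
  split_ifs with hj
  · congr! 6
    omega
  · simp only [Matrix.transpose_smul, Matrix.transpose_sum]
    rw [Finset.sum_comm]
    congr 1
    refine Finset.sum_congr rfl fun t _ => Finset.sum_congr rfl fun s _ => ?_
    rw [apply_ite Matrix.transpose, Matrix.transpose_vecMulVec, Matrix.transpose_zero]
    congr! 1
    omega

/-- Each pair `(t, s)` contributes to exactly one lag, `t - s`, which lies in the range of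
summation. -/
theorem psiHat_eq (y : EuclideanSpace ℝ (Fin n)) :
    psiHat w X y = (n : ℝ)⁻¹ • (Xᵀ * Matrix.diagonal (uHat X y) * weightMat n w *
      (Matrix.diagonal (uHat X y) * X)) := by
  have h1 : psiHat w X y = (n : ℝ)⁻¹ • ∑ t : Fin n, ∑ s : Fin n,
      w (((t : ℕ) : ℤ) - ((s : ℕ) : ℤ)) • Matrix.vecMulVec (vHat X y t) (vHat X y s) := by
    simp only [psiHat, gammaHat_eq, smul_comm (w _) ((n : ℝ)⁻¹), ← Finset.smul_sum]
    congr 1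
    simp only [Finset.smul_sum]
    rw [Finset.sum_comm]
    refine Finset.sum_congr rfl fun t _ => ?_
    rw [Finset.sum_comm]
    refine Finset.sum_congr rfl fun s _ => ?_
    simp only [smul_ite, smul_zero]
    rw [Finset.sum_ite_eq, if_pos]
    rw [Finset.mem_Icc]
    omega
  rw [h1]
  congr 1
  ext a b
  simp only [Matrix.sum_apply, Matrix.smul_apply, Matrix.vecMulVec_apply, vHat, Pi.smul_apply,
    smul_eq_mul]
  rw [Matrix.mul_apply]
  simp only [Matrix.mul_apply (M := Xᵀ * Matrix.diagonal (uHat X y)), Matrix.mul_diagonal,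
    Matrix.diagonal_mul, Matrix.transpose_apply, weightMat, Matrix.of_apply, Finset.sum_mul]
  rw [Finset.sum_comm]
  refine Finset.sum_congr rfl fun t _ => Finset.sum_congr rfl fun s _ => ?_
  ring

/-- This sandwich form yields positive definiteness off `Bset X R`, polynomial dependence on `y`,
and dependence on `y` through the residuals alone. -/
theorem omegaHat_eq (hn : n ≠ 0) (y : EuclideanSpace ℝ (Fin n)) :
    omegaHat w X R y = Bmat X R y * weightMat n w * (Bmat X R y)ᵀ := by
  have hg : ((Xᵀ * X)⁻¹)ᵀ = (Xᵀ * X)⁻¹ := by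
    rw [Matrix.transpose_nonsing_inv, Matrix.transpose_mul, Matrix.transpose_transpose]
  have hn' : (n : ℝ) ≠ 0 := by exact_mod_cast hn
  simp only [omegaHat, psiHat_eq, Matrix.mul_smul, Matrix.smul_mul, Bmat, Matrix.transpose_mul,
    Matrix.transpose_transpose, Matrix.diagonal_transpose, hg, Matrix.mul_assoc]
  rw [smul_smul, mul_inv_cancel₀ hn', one_smul]

theorem Bmat_congr {y y' : EuclideanSpace ℝ (Fin n)} (h : uHat X y = uHat X y') :
    Bmat X R y = Bmat X R y' := by
  rw [Bmat, Bmat, h]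

theorem omegaHat_posDef (hn : n ≠ 0) (hw : AssumptionAW n w) {y : EuclideanSpace ℝ (Fin n)}
    (hy : y ∉ Bset X R) : (omegaHat w X R y).PosDef := by
  have hr : (Bmat X R y).rank = Fintype.card (Fin q) := by
    refine le_antisymm (Matrix.rank_le_card_height _) ?_
    simpa [Bset] using hy
  rw [rank_eq_card_iff_vecMul] at hr
  rw [omegaHat_eq hn, ← Matrix.conjTranspose_eq_transpose_of_trivial]
  refine Matrix.PosDef.mul_mul_conjTranspose_same hw.2.2 ?_
  intro a b hab
  rw [← sub_eq_zero]
  apply hr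
  rw [Matrix.sub_vecMul, sub_eq_zero]
  exact hab

/-- The denominator of the test statistic. -/
noncomputable def denom (w : ℤ → ℝ) (X : Matrix (Fin n) (Fin k) ℝ) (R : Matrix (Fin q) (Fin k) ℝ)
    (y : EuclideanSpace ℝ (Fin n)) : ℝ := (omegaHat w X R y).det

/-- The numerator of the test statistic (for `r = 0`). -/
noncomputable def numer (w : ℤ → ℝ) (X : Matrix (Fin n) (Fin k) ℝ) (R : Matrix (Fin q) (Fin k) ℝ)
    (y : EuclideanSpace ℝ (Fin n)) : ℝ :=
  (R *ᵥ betaHat X y) ⬝ᵥ ((omegaHat w X R y).adjugate *ᵥ (R *ᵥ betaHat X y))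

/-- The adjugate replaces the inverse, leaving a quotient of polynomial functions; the value `0` at
singular points agrees with division by zero. -/
theorem Tw_zero_eq (y : EuclideanSpace ℝ (Fin n)) :
    Tw w X R 0 y = numer w X R y / denom w X R y := by
  unfold Tw numer denom
  split_ifs with h
  · rw [Matrix.inv_def, Ring.inverse_eq_inv', Matrix.smul_mulVec, dotProduct_smul, smul_eq_mul,
      sub_zero, div_eq_inv_mul]
  · push Not at h
    rw [h, div_zero]

theorem polyFun_omegaHat (hn : n ≠ 0) (i j : Fin q) :
    (fun y => omegaHat w X R y i j) ∈ polyFun (EuclideanSpace ℝ (Fin n)) := by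
  have hu : ∀ t : Fin n, (fun y => uHat X y t) ∈ polyFun (EuclideanSpace ℝ (Fin n)) := fun t =>
    polyFun_linear (LinearMap.proj t ∘ₗ uHatLin X)
  have : (fun y => omegaHat w X R y i j) = ∑ s, ∑ t,
      ((R * (Xᵀ * X)⁻¹ * Xᵀ) i t * weightMat n w t s * (R * (Xᵀ * X)⁻¹ * Xᵀ) j s) •
        ((fun y => uHat X y t) * fun y => uHat X y s) := by
    ext y
    rw [omegaHat_eq hn, Matrix.mul_apply]
    simp only [Finset.sum_apply, Pi.smul_apply, Pi.mul_apply, smul_eq_mul]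
    refine Finset.sum_congr rfl fun s _ => ?_
    rw [Matrix.mul_apply, Finset.sum_mul]
    refine Finset.sum_congr rfl fun t _ => ?_
    simp only [Bmat, Matrix.mul_diagonal, Matrix.transpose_apply]
    ring
  rw [this]
  exact sum_mem fun s _ => sum_mem fun t _ => Subalgebra.smul_mem _ (mul_mem (hu t) (hu s)) _

theorem polyFun_denom (hn : n ≠ 0) : denom w X R ∈ polyFun (EuclideanSpace ℝ (Fin n)) :=
  polyFun_det (polyFun_omegaHat hn)

theorem polyFun_numer (hn : n ≠ 0) : numer w X R ∈ polyFun (EuclideanSpace ℝ (Fin n)) := by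
  have hb : ∀ i : Fin q, (fun y => (R *ᵥ betaHat X y) i) ∈ polyFun (EuclideanSpace ℝ (Fin n)) :=
    fun i => polyFun_linear (LinearMap.proj i ∘ₗ R.mulVecLin ∘ₗ betaHatLin X)
  have : numer w X R = ∑ i, (fun y => (R *ᵥ betaHat X y) i) *
      ∑ j, (fun y => (omegaHat w X R y).adjugate i j) * fun y => (R *ᵥ betaHat X y) j := by
    ext y
    simp only [numer, dotProduct, Matrix.mulVec, Finset.sum_apply, Pi.mul_apply]
  rw [this]
  exact sum_mem fun i _ => mul_mem (hb i) (sum_mem fun j _ =>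
    mul_mem (polyFun_adjugate (polyFun_omegaHat hn) i j) (hb j))

theorem measurable_Tw_zero (hn : n ≠ 0) : Measurable (Tw w X R 0) := by
  have : Tw w X R 0 = fun y => numer w X R y / denom w X R y := funext Tw_zero_eq
  rw [this]
  exact (polyFun_numer hn).1.measurable.div (polyFun_denom hn).1.measurable

theorem continuousAt_Tw_zero (hn : n ≠ 0) {y : EuclideanSpace ℝ (Fin n)}
    (hy : denom w X R y ≠ 0) : ContinuousAt (Tw w X R 0) y := by
  have : Tw w X R 0 = fun y => numer w X R y / denom w X R y := funext Tw_zero_eq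
  rw [this]
  exact (polyFun_numer hn).1.continuousAt.div (polyFun_denom hn).1.continuousAt hy

theorem omegaHat_congr (hn : n ≠ 0) {y y' : EuclideanSpace ℝ (Fin n)}
    (h : uHat X y = uHat X y') : omegaHat w X R y = omegaHat w X R y' := by
  rw [omegaHat_eq hn, omegaHat_eq hn, Bmat_congr h]

/-- The residuals do not see `μ₀`, while `R *ᵥ betaHat` gains exactly `r`. -/
theorem Tw_add_of_mem_M0 (hn : n ≠ 0) (hX : X.rank = k) {μ₀ : EuclideanSpace ℝ (Fin n)}
    (hμ₀ : μ₀ ∈ M0 X R r) (y : EuclideanSpace ℝ (Fin n)) :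
    Tw w X R r (μ₀ + y) = Tw w X R 0 y := by
  obtain ⟨β, rfl, hβ⟩ := hμ₀
  have h1 : omegaHat w X R (WithLp.toLp 2 (X *ᵥ β) + y) = omegaHat w X R y := by
    refine omegaHat_congr hn ?_
    rw [add_comm, uHat_add_of_mem_colSpan hX _ (mem_colSpan_iff.2 ⟨β, rfl⟩)]
  have h2 : R *ᵥ betaHat X (WithLp.toLp 2 (X *ᵥ β) + y) - r = R *ᵥ betaHat X y - 0 := by
    rw [← betaHatLin_apply, map_add, betaHatLin_apply, betaHatLin_apply, betaHat_toLp hX,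
      Matrix.mulVec_add, hβ, add_sub_cancel_left, sub_zero]
  simp only [Tw, h1, h2]

theorem Tw_zero_add_of_mem_M0lin (hn : n ≠ 0) (hX : X.rank = k) {v : EuclideanSpace ℝ (Fin n)}
    (hv : v ∈ M0lin X R) (y : EuclideanSpace ℝ (Fin n)) :
    Tw w X R 0 (v + y) = Tw w X R 0 y :=
  Tw_add_of_mem_M0 hn hX hv y

theorem Tw_zero_smul (hn : n ≠ 0) {c : ℝ} (hc : c ≠ 0) (y : EuclideanSpace ℝ (Fin n)) :
    Tw w X R 0 (c • y) = Tw w X R 0 y := by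
  have h1 : omegaHat w X R (c • y) = (c ^ 2) • omegaHat w X R y := by
    have : Bmat X R (c • y) = c • Bmat X R y := by
      rw [Bmat, Bmat, ← uHatLin_apply, map_smul, uHatLin_apply, Matrix.diagonal_smul,
        Matrix.mul_smul]
    rw [omegaHat_eq hn, omegaHat_eq hn, this, Matrix.transpose_smul, Matrix.mul_smul,
      Matrix.smul_mul, Matrix.smul_mul, smul_smul, sq]
  have h2 : R *ᵥ betaHat X (c • y) = c • (R *ᵥ betaHat X y) := by
    rw [← betaHatLin_apply, map_smul, betaHatLin_apply, Matrix.mulVec_smul]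
  have hc2 : c ^ 2 ≠ 0 := pow_ne_zero 2 hc
  simp only [Tw, h1, h2, sub_zero, Matrix.det_smul, Fintype.card_fin, ne_eq, mul_eq_zero,
    pow_eq_zero_iff', hc2, false_and, false_or]
  split_ifs with h
  · rfl
  · have hu : IsUnit (omegaHat w X R y).det := isUnit_iff_ne_zero.2 h
    have : (c ^ 2 • omegaHat w X R y)⁻¹ = (c ^ 2)⁻¹ • (omegaHat w X R y)⁻¹ := by
      refine Matrix.inv_eq_left_inv ?_
      rw [Matrix.smul_mul, Matrix.mul_smul, smul_smul, inv_mul_cancel₀ hc2, one_smul,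
        Matrix.nonsing_inv_mul _ hu]
    rw [this, Matrix.smul_mulVec, Matrix.mulVec_smul, dotProduct_smul, dotProduct_smul,
      smul_dotProduct]
    simp only [smul_eq_mul]
    field_simp

theorem denom_congr (hn : n ≠ 0) {y y' : EuclideanSpace ℝ (Fin n)} (h : uHat X y = uHat X y') :
    denom w X R y = denom w X R y' := by
  rw [denom, denom, omegaHat_congr hn h]

theorem denom_ne_zero (hn : n ≠ 0) (hw : AssumptionAW n w) {y : EuclideanSpace ℝ (Fin n)}
    (hy : y ∉ Bset X R) : denom w X R y ≠ 0 :=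
  (omegaHat_posDef hn hw hy).det_pos.ne'

/-- A real vector space is not a finite union of proper subspaces, so some `u` orthogonal to
`colSpan X` has all its coordinates nonzero except where `e_i` lies in `colSpan X`. Since `u` is its
own residual, `Bmat X R u` inherits full row rank from the reduced matrix. -/
theorem exists_notMem_Bset (hRX : AssumptionRX X R) :
    ∃ y, y ∉ Bset X R := by
  classical
  obtain ⟨u, hu, hu0⟩ : ∃ u ∈ (colSpan X)ᗮ, ∀ i, EuclideanSpace.single i (1 : ℝ) ∉ colSpan X →
      u i ≠ 0 := by
    by_contra! hcon
    let p : {i : Fin n // EuclideanSpace.single i (1 : ℝ) ∉ colSpan X} →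
        Subspace ℝ ((colSpan X)ᗮ : Submodule ℝ (EuclideanSpace ℝ (Fin n))) := fun i =>
      LinearMap.ker ((EuclideanSpace.proj (𝕜 := ℝ) i.1 : EuclideanSpace ℝ (Fin n) →L[ℝ] ℝ).toLinearMap ∘ₗ
        ((colSpan X)ᗮ).subtype)
    obtain ⟨i, hi⟩ := Subspace.exists_eq_top_of_iUnion_eq_univ (p := p) (by
      ext ⟨u, hu⟩
      obtain ⟨i, hi, hi'⟩ := hcon u hu
      simp only [Set.mem_iUnion, Set.mem_univ, iff_true]
      exact ⟨⟨i, hi⟩, hi'⟩)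
    -- A coordinate vanishing on all of `(colSpan X)ᗮ` puts its basis vector into the double
    -- complement.
    apply i.2
    refine (Submodule.orthogonal_orthogonal (colSpan X)).le ?_
    intro v hv
    have h1 : (⟨v, hv⟩ : ((colSpan X)ᗮ : Submodule ℝ (EuclideanSpace ℝ (Fin n)))) ∈ p i :=
      hi ▸ Submodule.mem_top
    have h2 : v i.1 = 0 := h1
    simp [EuclideanSpace.inner_single_right, h2]
  refine ⟨u, ?_⟩
  simp only [Bset, Set.mem_ofPred_eq, not_lt]
  refine ge_of_eq ?_
  have h1 : ∀ v, v ᵥ* (R * (Xᵀ * X)⁻¹ * Xᵀ.submatrix id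
    (Subtype.val : {i : Fin n // EuclideanSpace.single i (1 : ℝ) ∉ colSpan X} → Fin n)) = 0 →
      v = 0 := by
    rw [← rank_eq_card_iff_vecMul, Fintype.card_fin]
    exact hRX
  have h2 : (Bmat X R u).rank = Fintype.card (Fin q) := by
    rw [rank_eq_card_iff_vecMul]
    intro v hv
    apply h1
    ext i
    have h3 := congrFun hv i.1
    rw [Bmat, uHat_of_mem_orthogonal hu, ← Matrix.vecMul_vecMul, Matrix.vecMul_diagonal] at h3
    have h4 := (mul_eq_zero.1 h3).resolve_right (hu0 i.1 i.2)
    rw [← Matrix.vecMul_vecMul] at h4 ⊢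
    exact h4
  simpa using h2

/-- The test statistic is not constant. -/
theorem exists_numer_ne (hn : n ≠ 0) (hq : 1 ≤ q) (hX : X.rank = k) (hR : R.rank = q)
    (hw : AssumptionAW n w) (hRX : AssumptionRX X R) (c : ℝ) :
    ∃ y, numer w X R y - c * denom w X R y ≠ 0 := by
  obtain ⟨y₀, hy₀⟩ := exists_notMem_Bset hRX
  -- Adding elements of `colSpan X` moves the estimator freely with `omegaHat` fixed. The choice `β
  -- = 0` forces `c = 0`, and any `β` with `R *ᵥ β ≠ 0` then gives a positive numerator.
  have hmod : ∀ β : Fin k → ℝ, ∃ y, omegaHat w X R y = omegaHat w X R y₀ ∧ betaHat X y = β := by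
    intro β
    refine ⟨y₀ + WithLp.toLp 2 (X *ᵥ (β - betaHat X y₀)), omegaHat_congr hn
      (uHat_add_of_mem_colSpan hX _ (mem_colSpan_iff.2 ⟨_, rfl⟩)), ?_⟩
    rw [← betaHatLin_apply, map_add, betaHatLin_apply, betaHatLin_apply, betaHat_toLp hX]
    simp
  have hpd := omegaHat_posDef (R := R) hn hw hy₀
  by_contra! hcon
  have h0 : c = 0 := by
    obtain ⟨y, hy, hy'⟩ := hmod 0
    have := hcon y
    simpa [numer, denom, hy, hy', hpd.det_pos.ne'] using this
  obtain ⟨β, hβ⟩ : ∃ β : Fin k → ℝ, R *ᵥ β ≠ 0 := by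
    by_contra! h
    have : R = 0 := by
      ext i j
      simpa using congrFun (h (Pi.single j 1)) i
    rw [this, Matrix.rank_zero] at hR
    omega
  obtain ⟨y, hy, hy'⟩ := hmod β
  have h1 := hcon y
  have h2 := hpd.inv.dotProduct_mulVec_pos hβ
  rw [Matrix.inv_def, Ring.inverse_eq_inv', Matrix.smul_mulVec, dotProduct_smul] at h2
  simp only [h0, numer, hy, hy', zero_mul, sub_zero] at h1
  rw [star_trivial, h1, smul_zero] at h2
  exact h2.false

end SizeControl

namespace SizeControl
open MeasureTheory Polynomial

/-! ### Covariance matrices as quadratic forms in polynomials on the unit circle -/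

/-- The function `ω ↦ |p(e^{iω})|²`. -/
noncomputable def normSqCirc (p : ℝ[X]) (ω : ℝ) : ℝ := ‖aeval (circ ω) p‖ ^ 2

theorem continuous_normSqCirc (p : ℝ[X]) : Continuous (normSqCirc p) := by
  have : Continuous fun ω => aeval (circ ω) p := (Polynomial.continuous_aeval p).comp continuous_circ
  exact this.norm.pow 2

theorem normSqCirc_nonneg (p : ℝ[X]) (ω : ℝ) : 0 ≤ normSqCirc p ω := sq_nonneg _

theorem normSqCirc_mul (p q : ℝ[X]) (ω : ℝ) :
    normSqCirc (p * q) ω = normSqCirc p ω * normSqCirc q ω := by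
  simp [normSqCirc, mul_pow]

theorem normSqCirc_eq_zero {p : ℝ[X]} {ω : ℝ} : normSqCirc p ω = 0 ↔ aeval (circ ω) p = 0 := by
  simp [normSqCirc]

theorem normSqCirc_neg (p : ℝ[X]) (ω : ℝ) : normSqCirc p (-ω) = normSqCirc p ω := by
  have h : circ (-ω) = (starRingEnd ℂ) (circ ω) := by
    rw [circ_eq, circ_eq]; apply Complex.ext <;> simp
  rw [normSqCirc, normSqCirc, h, Polynomial.aeval_conj, RCLike.norm_conj]

theorem normSqCirc_abs (p : ℝ[X]) (ω : ℝ) : normSqCirc p |ω| = normSqCirc p ω := by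
  rcases abs_choice ω with h | h <;> rw [h]
  exact normSqCirc_neg p ω

theorem finite_zeros_circ {p : ℝ[X]} (hp : p ≠ 0) :
    {ω : ℝ | ω ∈ Set.Icc (-Real.pi) Real.pi ∧ normSqCirc p ω = 0}.Finite := by
  have hp' : p.map (algebraMap ℝ ℂ) ≠ 0 := by
    rwa [Ne, Polynomial.map_eq_zero]
  -- `Complex.arg` inverts `circ` on `(-π, π]`; the endpoint `-π` is added by hand.
  refine ((Set.finite_singleton (-Real.pi)).union
    ((p.map (algebraMap ℝ ℂ)).roots.toFinset.finite_toSet.image Complex.arg)).subset ?_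
  rintro ω ⟨hω, h0⟩
  rw [normSqCirc_eq_zero] at h0
  rcases hω.1.eq_or_lt with h | h
  · exact Or.inl h.symm
  · refine Or.inr ⟨circ ω, ?_, ?_⟩
    · simp only [Finset.mem_coe, Multiset.mem_toFinset, mem_roots hp', IsRoot.def, eval_map_algebraMap]
      exact h0
    · rw [circ, mul_comm, Complex.exp_mul_I]
      exact Complex.arg_cos_add_sin_mul_I ⟨h, hω.2⟩

theorem integrableOn_continuous_mul {f g : ℝ → ℝ}
    (hf : IntegrableOn f (Set.Icc (-Real.pi) Real.pi)) (hg : Continuous g) :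
    IntegrableOn (fun ω => g ω * f ω) (Set.Icc (-Real.pi) Real.pi) :=
  hf.continuousOn_mul hg.continuousOn isCompact_Icc

variable {n : ℕ}

theorem Sig_apply {f : ℝ → ℝ} (hf : f ∈ Fall) (j l : Fin n) :
    Sig n f j l = ∫ ω in Set.Icc (-Real.pi) Real.pi,
      (circ ω ^ (l : ℕ) * (starRingEnd ℂ) (circ ω ^ (j : ℕ))).re * f ω := by
  have h1 : ∀ ω : ℝ, Complex.exp (-(Complex.I * (((j : ℕ) : ℂ) - ((l : ℕ) : ℂ)) * (ω : ℂ))) =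
      circ ω ^ (l : ℕ) * (starRingEnd ℂ) (circ ω ^ (j : ℕ)) := by
    intro ω
    rw [circ_pow, circ_pow, circ, circ, ← Complex.exp_conj, ← Complex.exp_add]
    congr 1
    simp
    ring
  have hc : Continuous fun ω : ℝ => circ ω ^ (l : ℕ) * (starRingEnd ℂ) (circ ω ^ (j : ℕ)) :=
    (continuous_circ.pow _).mul (Complex.continuous_conj.comp (continuous_circ.pow _))
  have hi : IntegrableOn (fun ω => (circ ω ^ (l : ℕ) * (starRingEnd ℂ) (circ ω ^ (j : ℕ))) *
      (f ω : ℂ)) (Set.Icc (-Real.pi) Real.pi) :=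
    IntegrableOn.continuousOn_mul hc.continuousOn hf.2.1.ofReal isCompact_Icc
  simp only [Sig, Matrix.of_apply, h1]
  have h2 := integral_re hi
  simp only [RCLike.re_eq_complex_re, Complex.re_mul_ofReal] at h2
  exact h2.symm

/-- The double sum of exponentials is `|p(e^{iω})|²` expanded, with `p = obsPoly x`. -/
theorem Sig_quadratic {f : ℝ → ℝ} (hf : f ∈ Fall) (x : EuclideanSpace ℝ (Fin n)) :
    x.ofLp ⬝ᵥ Sig n f *ᵥ x.ofLp =
      ∫ ω in Set.Icc (-Real.pi) Real.pi, normSqCirc (obsPoly x) ω * f ω := by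
  have hi : ∀ j l : Fin n, IntegrableOn (fun ω => x j * ((circ ω ^ (l : ℕ) *
      (starRingEnd ℂ) (circ ω ^ (j : ℕ))).re * f ω * x l)) (Set.Icc (-Real.pi) Real.pi) := by
    intro j l
    refine ((integrableOn_continuous_mul hf.2.1 ?_).mul_const _).const_mul _
    exact Complex.continuous_re.comp ((continuous_circ.pow _).mul
      (Complex.continuous_conj.comp (continuous_circ.pow _)))
  simp only [dotProduct, Matrix.mulVec, Sig_apply hf, Finset.mul_sum, ← integral_mul_const,
    ← integral_const_mul]
  rw [← (Finset.sum_congr rfl fun j _ => integral_finsetSum _ fun l _ => hi j l),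
    ← integral_finsetSum _ fun j _ => integrable_finsetSum _ fun l _ => hi j l]
  congr 1
  ext ω
  have h1 : aeval (circ ω) (obsPoly x) = ∑ l : Fin n, (x l : ℂ) * circ ω ^ (l : ℕ) := by
    simp [obsPoly]
  have h2 : normSqCirc (obsPoly x) ω = (aeval (circ ω) (obsPoly x) *
      (starRingEnd ℂ) (aeval (circ ω) (obsPoly x))).re := by
    rw [Complex.mul_conj, Complex.ofReal_re, normSqCirc, Complex.normSq_eq_norm_sq]
  rw [h2, h1, map_sum, Finset.sum_mul_sum, Complex.re_sum, Finset.sum_mul, Finset.sum_comm]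
  refine Finset.sum_congr rfl fun l _ => ?_
  rw [Complex.re_sum, Finset.sum_mul]
  refine Finset.sum_congr rfl fun j _ => ?_
  have h3 : (x l : ℂ) * circ ω ^ (l : ℕ) * (starRingEnd ℂ) ((x j : ℂ) * circ ω ^ (j : ℕ)) =
      ((x l * x j : ℝ) : ℂ) * (circ ω ^ (l : ℕ) * (starRingEnd ℂ) (circ ω ^ (j : ℕ))) := by
    rw [map_mul, Complex.conj_ofReal]
    push_cast
    ring
  rw [h3, Complex.re_ofReal_mul]
  ring

/-- A nonzero polynomial has finitely many zeros on the circle, so a vanishing integral would force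
`f = 0` almost everywhere, against its total mass one. -/
theorem integral_normSqCirc_pos {f : ℝ → ℝ} (hf : f ∈ Fall) {p : ℝ[X]} (hp : p ≠ 0) :
    0 < ∫ ω in Set.Icc (-Real.pi) Real.pi, normSqCirc p ω * f ω := by
  have hnn : ∀ ω ∈ Set.Icc (-Real.pi) Real.pi, 0 ≤ normSqCirc p ω * f ω := fun ω hω =>
    mul_nonneg (normSqCirc_nonneg p ω) (hf.1 ω hω).1
  refine (setIntegral_nonneg measurableSet_Icc hnn).lt_of_ne' fun h0 => ?_
  rw [setIntegral_eq_zero_iff_of_nonneg_ae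
    ((ae_restrict_iff' measurableSet_Icc).2 (Filter.Eventually.of_forall hnn))
    (integrableOn_continuous_mul hf.2.1 (continuous_normSqCirc p))] at h0
  have h1 : ∀ᵐ ω ∂volume.restrict (Set.Icc (-Real.pi) Real.pi), f ω = 0 := by
    have h2 := (measure_eq_zero_iff_ae_notMem.1 ((finite_zeros_circ hp).measure_zero volume))
    filter_upwards [h0, ae_restrict_of_ae h2, ae_restrict_mem measurableSet_Icc] with ω h3 h4 h5
    exact (mul_eq_zero.1 h3).resolve_left fun h6 => h4 ⟨h5, h6⟩
  have h2 := hf.2.2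
  rw [integral_congr_ae h1] at h2
  simp at h2

theorem Sig_isHermitian {f : ℝ → ℝ} (hf : f ∈ Fall) : (Sig n f).IsHermitian := by
  ext j l
  rw [Matrix.conjTranspose_apply, star_trivial, Sig_apply hf, Sig_apply hf]
  congr 1
  ext ω
  rw [← Complex.conj_re, map_mul, Complex.conj_conj, mul_comm (_ ^ _)]

theorem Sig_posSemidef {f : ℝ → ℝ} (hf : f ∈ Fall) : (Sig n f).PosSemidef := by
  refine Matrix.PosSemidef.of_dotProduct_mulVec_nonneg (Sig_isHermitian hf) fun x => ?_
  rw [star_trivial]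
  refine (setIntegral_nonneg measurableSet_Icc fun ω hω => ?_).trans_eq
    (Sig_quadratic hf (WithLp.toLp 2 x)).symm
  exact mul_nonneg (normSqCirc_nonneg _ ω) (hf.1 ω hω).1

theorem Sig_quadratic_pos {f : ℝ → ℝ} (hf : f ∈ Fall) {x : EuclideanSpace ℝ (Fin n)}
    (hx : x ≠ 0) : 0 < x.ofLp ⬝ᵥ Sig n f *ᵥ x.ofLp := by
  rw [Sig_quadratic hf]
  exact integral_normSqCirc_pos hf (obsPoly_ne_zero hx)

/-! ### Divisibility by `DelL` -/

variable {L : Submodule ℝ (EuclideanSpace ℝ (Fin n))}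

theorem orthogonal_iff_aeval (x : EuclideanSpace ℝ (Fin n)) (s : ℕ) (ω : ℝ) :
    x ∈ (colSpan (E n s ω))ᗮ ↔ aeval (circ ω) ((shiftDeriv ^ s) (obsPoly x)) = 0 :=
  forall_colSpan_E_inner_eq_zero_iff x s ω

theorem exists_orthogonal_ne_zero (hL : L ≠ ⊤) : ∃ x ∈ Lᗮ, x ≠ 0 := by
  refine Submodule.exists_mem_ne_zero_of_ne_bot fun h => hL ?_
  rwa [Submodule.orthogonal_eq_bot_iff] at h

theorem le_kappa (ω : ℝ) (d : ℕ) : d ≤ kappa ω d := by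
  unfold kappa; split_ifs <;> omega

theorem Del_pow_rho_dvd {ω : ℝ} (hω : ω ∈ Set.Icc 0 Real.pi) {x : EuclideanSpace ℝ (Fin n)}
    (hx : x ∈ Lᗮ) : Del ω ^ rho ω L ∣ obsPoly x := by
  rw [Del_pow_dvd_iff hω]
  intro s hs
  have h1 := Nat.notMem_of_lt_sInf hs
  rw [Set.mem_ofPred_eq, not_not] at h1
  rw [← orthogonal_iff_aeval]
  exact Submodule.orthogonal_le h1 hx

/-- The set whose infimum is `rho` must be shown nonempty. Otherwise `Del ω ^ n` would divide a
nonzero polynomial of degree less than `n`. -/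
theorem colSpan_Erho_not_le (hL : L ≠ ⊤) {ω : ℝ} (hω : ω ∈ Set.Icc 0 Real.pi) :
    ¬ colSpan (Erho L ω) ≤ L := by
  refine Nat.sInf_mem (s := {s : ℕ | ¬ colSpan (E n s ω) ≤ L}) ?_
  obtain ⟨x, hx, hx0⟩ := exists_orthogonal_ne_zero hL
  by_contra hne
  rw [Set.not_nonempty_iff_eq_empty] at hne
  have h1 : Del ω ^ n ∣ obsPoly x := by
    rw [Del_pow_dvd_iff hω]
    intro s _
    have h2 : s ∉ {s : ℕ | ¬ colSpan (E n s ω) ≤ L} := by rw [hne]; simp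
    rw [Set.mem_ofPred_eq, not_not] at h2
    rw [← orthogonal_iff_aeval]
    exact Submodule.orthogonal_le h2 hx
  have h2 := natDegree_le_of_dvd h1 (obsPoly_ne_zero hx0)
  rw [natDegree_Del_pow] at h2
  have h3 := natDegree_obsPoly_lt hx0
  have h4 := le_kappa ω n
  omega

theorem mem_Icc_neg_pi {ω : ℝ} (hω : ω ∈ Set.Icc 0 Real.pi) :
    ω ∈ Set.Icc (-Real.pi) Real.pi :=
  ⟨by linarith [hω.1, Real.pi_pos], hω.2⟩

theorem finite_freqs (hL : L ≠ ⊤) : (freqs L).Finite := by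
  obtain ⟨x, hx, hx0⟩ := exists_orthogonal_ne_zero hL
  refine (finite_zeros_circ (obsPoly_ne_zero hx0)).subset ?_
  rintro ω ⟨hω, hr⟩
  refine ⟨mem_Icc_neg_pi hω, ?_⟩
  rw [normSqCirc_eq_zero, ← Del_dvd_iff hω]
  exact (dvd_pow_self _ hr.ne').trans (Del_pow_rho_dvd hω hx)

theorem DelL_eq (hL : L ≠ ⊤) : DelL L = ∏ ω ∈ (finite_freqs hL).toFinset, Del ω ^ rho ω L :=
  finprod_mem_eq_finite_toFinset_prod _ _

theorem DelL_ne_zero (hL : L ≠ ⊤) : DelL L ≠ 0 := by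
  rw [DelL_eq hL]
  exact Finset.prod_ne_zero_iff.2 fun ω _ => pow_ne_zero _ (Del_ne_zero ω)

theorem natDegree_DelL (hL : L ≠ ⊤) : (DelL L).natDegree = kappaL L := by
  rw [DelL_eq hL, natDegree_prod _ _ fun ω _ => pow_ne_zero _ (Del_ne_zero ω), kappaL,
    finsum_mem_eq_finite_toFinset_sum _ (finite_freqs hL)]
  exact Finset.sum_congr rfl fun ω _ => natDegree_Del_pow _ _

theorem DelL_dvd (hL : L ≠ ⊤) {x : EuclideanSpace ℝ (Fin n)} (hx : x ∈ Lᗮ) :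
    DelL L ∣ obsPoly x := by
  rw [DelL_eq hL]
  refine Finset.prod_dvd_of_coprime ?_ fun ω hω => ?_
  · intro ω hω γ hγ hne
    simp only [Set.Finite.coe_toFinset] at hω hγ
    exact (Del_isCoprime hω.1 hγ.1 hne).pow
  · rw [Set.Finite.mem_toFinset] at hω
    exact Del_pow_rho_dvd hω.1 hx

/-- The quotient of `obsPoly x` by `DelL L`. -/
noncomputable def quotPoly (L : Submodule ℝ (EuclideanSpace ℝ (Fin n)))
    (x : EuclideanSpace ℝ (Fin n)) : ℝ[X] := obsPoly x / DelL L

theorem DelL_mul_quotPoly (hL : L ≠ ⊤) {x : EuclideanSpace ℝ (Fin n)} (hx : x ∈ Lᗮ) :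
    DelL L * quotPoly L x = obsPoly x :=
  EuclideanDomain.mul_div_cancel' (DelL_ne_zero hL) (DelL_dvd hL hx)

/-- `DelL L` already carries `Del γ` to the power `rho γ L`; a zero of the quotient adds one more
factor, which is the orthogonality condition of order `rho γ L`. -/
theorem mem_orthogonal_Erho (hL : L ≠ ⊤) {x : EuclideanSpace ℝ (Fin n)} (hx : x ∈ Lᗮ)
    {γ : ℝ} (hγ : γ ∈ Set.Icc 0 Real.pi) (h : aeval (circ γ) (quotPoly L x) = 0) :
    x ∈ (colSpan (Erho L γ))ᗮ := by
  have h1 : Del γ ^ rho γ L ∣ DelL L := by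
    by_cases h0 : 0 < rho γ L
    · rw [DelL_eq hL]
      exact Finset.dvd_prod_of_mem (fun ω => Del ω ^ rho ω L)
        ((finite_freqs hL).mem_toFinset.2 ⟨hγ, h0⟩)
    · simp [show rho γ L = 0 by omega]
  have h2 : Del γ ^ (rho γ L + 1) ∣ obsPoly x := by
    rw [← DelL_mul_quotPoly hL hx, pow_succ]
    exact mul_dvd_mul h1 ((Del_dvd_iff hγ _).2 h)
  rw [Erho, orthogonal_iff_aeval]
  exact (Del_pow_dvd_iff hγ _ _).1 h2 _ (Nat.lt_succ_self _)

/-- Degree count: `DelL L` times the coprime factors `Del γ` divides `obsPoly x`, of degree less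
than `n`. This is the support bound in `MM`. -/
theorem sum_kappa_add_kappaL_lt (hL : L ≠ ⊤) {x : EuclideanSpace ℝ (Fin n)} (hx : x ∈ Lᗮ)
    (hx0 : x ≠ 0) (Γ : Finset ℝ) (hΓ : ∀ γ ∈ Γ, γ ∈ Set.Icc 0 Real.pi)
    (h : ∀ γ ∈ Γ, aeval (circ γ) (quotPoly L x) = 0) :
    ∑ γ ∈ Γ, kappa γ 1 + kappaL L < n := by
  have h1 : ∏ γ ∈ Γ, Del γ ^ 1 ∣ quotPoly L x := by
    refine Finset.prod_dvd_of_coprime ?_ fun γ hγ => ?_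
    · intro ω hω γ hγ hne
      exact (Del_isCoprime (hΓ _ hω) (hΓ _ hγ) hne).pow
    · rw [pow_one]
      exact (Del_dvd_iff (hΓ _ hγ) _).2 (h γ hγ)
  have h2 := mul_dvd_mul_left (DelL L) h1
  rw [DelL_mul_quotPoly hL hx] at h2
  have h3 := natDegree_le_of_dvd h2 (obsPoly_ne_zero hx0)
  have h4 := natDegree_obsPoly_lt hx0
  have h5 : ∏ γ ∈ Γ, Del γ ^ 1 ≠ 0 :=
    Finset.prod_ne_zero_iff.2 fun ω _ => pow_ne_zero _ (Del_ne_zero ω)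
  rw [natDegree_mul (DelL_ne_zero hL) h5, natDegree_DelL hL,
    natDegree_prod _ _ fun ω _ => pow_ne_zero _ (Del_ne_zero ω),
    Finset.sum_congr rfl fun γ _ => natDegree_Del_pow γ 1] at h3
  omega

end SizeControl

namespace SizeControl
open MeasureTheory Polynomial Filter Topology

/-! ### The measures with densities `gden L f` -/

variable {n : ℕ} {L : Submodule ℝ (EuclideanSpace ℝ (Fin n))}

theorem filtered_eq (f : ℝ → ℝ) (ν : ℝ) : filtered L f ν = normSqCirc (DelL L) ν * f ν := rfl

theorem integral_filtered_pos (hL : L ≠ ⊤) {f : ℝ → ℝ} (hf : f ∈ Fall) :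
    0 < ∫ ν in Set.Icc (-Real.pi) Real.pi, filtered L f ν :=
  integral_normSqCirc_pos hf (DelL_ne_zero hL)

theorem integrableOn_gden {f : ℝ → ℝ} (hf : f ∈ Fall) :
    IntegrableOn (gden L f) (Set.Icc (-Real.pi) Real.pi) :=
  (integrableOn_continuous_mul hf.2.1 (continuous_normSqCirc (DelL L))).div_const _

theorem gden_nonneg (hL : L ≠ ⊤) {f : ℝ → ℝ} (hf : f ∈ Fall) {ν : ℝ}
    (hν : ν ∈ Set.Icc (-Real.pi) Real.pi) : 0 ≤ gden L f ν :=
  div_nonneg (mul_nonneg (normSqCirc_nonneg _ _) (hf.1 ν hν).1) (integral_filtered_pos hL hf).le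

theorem isProbabilityMeasure_specMeasure (hL : L ≠ ⊤) {f : ℝ → ℝ} (hf : f ∈ Fall) :
    IsProbabilityMeasure (specMeasure (gden L f)) := by
  constructor
  rw [specMeasure, withDensity_apply _ MeasurableSet.univ, Measure.restrict_univ,
    ← ofReal_integral_eq_lintegral_ofReal (integrableOn_gden hf)
      ((ae_restrict_iff' measurableSet_Icc).2 (Eventually.of_forall fun ν hν =>
        gden_nonneg hL hf hν))]
  simp only [gden]
  rw [integral_div, div_self (integral_filtered_pos hL hf).ne', ENNReal.ofReal_one]

theorem specMeasure_compl (g : ℝ → ℝ) : specMeasure g (Set.Icc (-Real.pi) Real.pi)ᶜ = 0 := by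
  refine withDensity_absolutelyContinuous _ _ ?_
  rw [Measure.restrict_apply measurableSet_Icc.compl]
  simp

theorem integral_specMeasure (hL : L ≠ ⊤) {f : ℝ → ℝ} (hf : f ∈ Fall) (h : ℝ → ℝ) :
    ∫ ν, h ν ∂specMeasure (gden L f) =
      ∫ ν in Set.Icc (-Real.pi) Real.pi, h ν * gden L f ν := by
  rw [specMeasure, integral_withDensity_eq_integral_toReal_smul₀
    (integrableOn_gden hf).aestronglyMeasurable.aemeasurable.ennreal_ofReal
    (Eventually.of_forall fun _ => ENNReal.ofReal_lt_top)]
  refine setIntegral_congr_fun measurableSet_Icc fun ν hν => ?_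
  simp only [smul_eq_mul]
  rw [ENNReal.toReal_ofReal (gden_nonneg hL hf hν), mul_comm]

/-- Factoring out `DelL L` separates a scalar depending only on `f` from an integral that is weakly
continuous in the measure. -/
theorem Sig_quadratic_eq_integral_specMeasure (hL : L ≠ ⊤) {f : ℝ → ℝ} (hf : f ∈ Fall)
    {x : EuclideanSpace ℝ (Fin n)} (hx : x ∈ Lᗮ) :
    x.ofLp ⬝ᵥ Sig n f *ᵥ x.ofLp = (∫ ν in Set.Icc (-Real.pi) Real.pi, filtered L f ν) *
      ∫ ν, normSqCirc (quotPoly L x) ν ∂specMeasure (gden L f) := by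
  rw [Sig_quadratic hf, integral_specMeasure hL hf, ← integral_const_mul]
  refine integral_congr_ae (Eventually.of_forall fun ν => ?_)
  have h := (integral_filtered_pos hL hf).ne'
  simp only [gden, ← DelL_mul_quotPoly hL hx, normSqCirc_mul, filtered_eq] at h ⊢
  field_simp

theorem specMeasure_map_neg {f : ℝ → ℝ} (hf : f ∈ Fall) :
    (specMeasure (gden L f)).map (fun x => -x) = specMeasure (gden L f) := by
  have hI : (fun x : ℝ => -x) ⁻¹' Set.Icc (-Real.pi) Real.pi = Set.Icc (-Real.pi) Real.pi := by
    ext x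
    simp only [Set.mem_preimage, Set.mem_Icc]
    constructor <;> rintro ⟨h1, h2⟩ <;> constructor <;> linarith
  have hp : MeasurePreserving (fun x : ℝ => -x) (volume.restrict (Set.Icc (-Real.pi) Real.pi))
      (volume.restrict (Set.Icc (-Real.pi) Real.pi)) := by
    have := (Measure.measurePreserving_neg (volume : Measure ℝ)).restrict_preimage
      (measurableSet_Icc (a := -Real.pi) (b := Real.pi))
    rwa [hI] at this
  ext A hA
  rw [Measure.map_apply measurable_neg hA, specMeasure, withDensity_apply _ (measurable_neg hA),
    withDensity_apply _ hA]
  refine Eq.trans (lintegral_congr_ae (ae_restrict_of_ae ?_))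
    (hp.setLIntegral_comp_preimage_emb (MeasurableEquiv.neg ℝ).measurableEmbedding _ A)
  filter_upwards [ae_restrict_mem measurableSet_Icc] with ν hν
  simp only [gden, filtered_eq, normSqCirc_neg, (hf.1 ν hν).2]

/-! ### Weak limits of the filtered spectral measures. -/

/-- The measure with density `gden L f` as a probability measure. -/
noncomputable def specProb (hL : L ≠ ⊤) {f : ℝ → ℝ} (hf : f ∈ Fall) : ProbabilityMeasure ℝ :=
  ⟨specMeasure (gden L f), isProbabilityMeasure_specMeasure hL hf⟩

/-- All the measures live on one compact interval, so the sequence is tight and no mass escapes in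
the limit. -/
theorem specProb_tendsto_subseq (hL : L ≠ ⊤) {f : ℕ → ℝ → ℝ} (hf : ∀ j, f j ∈ Fall) :
    ∃ (μ : ProbabilityMeasure ℝ) (φ : ℕ → ℕ), StrictMono φ ∧
      Tendsto (fun j => specProb hL (hf (φ j))) atTop (𝓝 μ) ∧
      (μ : Measure ℝ) (Set.Icc (-Real.pi) Real.pi)ᶜ = 0 := by
  have hc := isCompact_setOfPred_probabilityMeasure_mass_eq_compl_isCompact_le
    (E := ℝ) (u := fun _ => 0) (K := fun _ => Set.Icc (-Real.pi) Real.pi) tendsto_const_nhds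
    (fun _ => isCompact_Icc) (Or.inl inferInstance)
  obtain ⟨μ, hμ, φ, hφ, hlim⟩ := hc.tendsto_subseq (x := fun j => specProb hL (hf j)) (by
    intro j
    simp only [Set.mem_ofPred_eq]
    intro _
    rw [le_zero_iff, ProbabilityMeasure.null_iff_toMeasure_null]
    exact specMeasure_compl _)
  refine ⟨μ, φ, hφ, hlim, ?_⟩
  have h := hμ 0
  rwa [le_zero_iff, ProbabilityMeasure.null_iff_toMeasure_null] at h

/-- The values of `normSqCirc p` as a bounded continuous function. -/
noncomputable def normSqCircBdd (p : ℝ[X]) : BoundedContinuousFunction ℝ ℝ :=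
  BoundedContinuousFunction.ofNormedAddCommGroup (normSqCirc p) (continuous_normSqCirc p)
    ((∑ j ∈ p.support, ‖p.coeff j‖) ^ 2) fun ω => by
      have h1 : ‖aeval (circ ω) p‖ ≤ ∑ j ∈ p.support, ‖p.coeff j‖ := by
        rw [aeval_def, eval₂_eq_sum, sum_def]
        refine norm_sum_le_of_le _ fun j _ => ?_
        have h2 : ‖circ ω‖ = 1 := by rw [circ, mul_comm, Complex.norm_exp_ofReal_mul_I]
        simp [h2]
      rw [Real.norm_of_nonneg (normSqCirc_nonneg p ω), normSqCirc]
      gcongr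

theorem tendsto_integral_normSqCirc {M : ℕ → ProbabilityMeasure ℝ} {μ : ProbabilityMeasure ℝ}
    (h : Tendsto M atTop (𝓝 μ)) (p : ℝ[X]) :
    Tendsto (fun j => ∫ ν, normSqCirc p ν ∂(M j : Measure ℝ)) atTop
      (𝓝 (∫ ν, normSqCirc p ν ∂(μ : Measure ℝ))) :=
  ProbabilityMeasure.tendsto_iff_forall_integral_tendsto.1 h (normSqCircBdd p)

theorem integral_normSqCirc_eq_zero_iff (μ : ProbabilityMeasure ℝ) (p : ℝ[X]) :
    ∫ ν, normSqCirc p ν ∂(μ : Measure ℝ) = 0 ↔ ∀ ν ∈ (μ : Measure ℝ).support, normSqCirc p ν = 0 := by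
  rw [integral_eq_zero_iff_of_nonneg (normSqCirc_nonneg p) ((normSqCircBdd p).integrable _)]
  constructor
  · intro h ν hν
    by_contra hne
    have ho : IsOpen {ν | normSqCirc p ν ≠ 0} :=
      isOpen_ne_fun (continuous_normSqCirc p) continuous_const
    have h1 := (Measure.mem_support_iff_forall ν).1 hν _ (ho.mem_nhds hne)
    exact h1.ne' h
  · intro h
    filter_upwards [Measure.support_mem_ae (μ := (μ : Measure ℝ))] with ν hν
    exact h ν hν

theorem support_subset_Icc {μ : ProbabilityMeasure ℝ}
    (h : (μ : Measure ℝ) (Set.Icc (-Real.pi) Real.pi)ᶜ = 0) :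
    (μ : Measure ℝ).support ⊆ Set.Icc (-Real.pi) Real.pi :=
  Measure.support_subset_of_isClosed isClosed_Icc h

theorem abs_mem_Icc {γ : ℝ} (hγ : γ ∈ Set.Icc (-Real.pi) Real.pi) : |γ| ∈ Set.Icc 0 Real.pi :=
  ⟨abs_nonneg γ, abs_le.2 hγ⟩

/-- Otherwise every quotient vanishes at a support point `γ`, and all of `Lᗮ` is orthogonal to `Erho
L |γ|`, contradicting `colSpan_Erho_not_le`. -/
theorem exists_integral_normSqCirc_pos (hL : L ≠ ⊤) {μ : ProbabilityMeasure ℝ}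
    (h : (μ : Measure ℝ) (Set.Icc (-Real.pi) Real.pi)ᶜ = 0) :
    ∃ x ∈ Lᗮ, 0 < ∫ ν, normSqCirc (quotPoly L x) ν ∂(μ : Measure ℝ) := by
  have hne : (μ : Measure ℝ) ≠ 0 := IsProbabilityMeasure.ne_zero _
  obtain ⟨γ, hγ⟩ := Measure.nonempty_support hne
  by_contra! hcon
  have hγ' := abs_mem_Icc (support_subset_Icc h hγ)
  refine colSpan_Erho_not_le hL hγ' ?_
  refine le_trans ?_ (Submodule.orthogonal_orthogonal L).le
  rw [Submodule.le_orthogonal_iff_le_orthogonal]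
  intro x hx
  refine mem_orthogonal_Erho hL hx hγ' ?_
  have h0 : ∫ ν, normSqCirc (quotPoly L x) ν ∂(μ : Measure ℝ) = 0 :=
    le_antisymm (hcon x hx) (integral_nonneg (normSqCirc_nonneg _))
  rw [integral_normSqCirc_eq_zero_iff] at h0
  rw [← normSqCirc_eq_zero, normSqCirc_abs]
  exact h0 γ hγ

/-- A weak limit of the measures with densities `gden L f`, for which some nonzero `x` in the
orthogonal complement of `L` has a vanishing quadratic form, belongs to `MM F L`. -/
theorem mem_MM (hL : L ≠ ⊤) {F : Set (ℝ → ℝ)} (hF : F ⊆ Fall) {f : ℕ → ℝ → ℝ}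
    (hf : ∀ j, f j ∈ F) {μ : ProbabilityMeasure ℝ}
    (hμ : Tendsto (fun j => specProb hL (hF (hf j))) atTop (𝓝 μ))
    (hI : (μ : Measure ℝ) (Set.Icc (-Real.pi) Real.pi)ᶜ = 0)
    {x : EuclideanSpace ℝ (Fin n)} (hx : x ∈ Lᗮ) (hx0 : x ≠ 0)
    (h0 : ∫ ν, normSqCirc (quotPoly L x) ν ∂(μ : Measure ℝ) = 0) :
    μ.toFiniteMeasure ∈ MM F L := by
  rw [integral_normSqCirc_eq_zero_iff] at h0
  have hq : quotPoly L x ≠ 0 := by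
    intro h
    apply obsPoly_ne_zero hx0
    rw [← DelL_mul_quotPoly hL hx, h, mul_zero]
  have hfin : (μ : Measure ℝ).support.Finite :=
    (finite_zeros_circ hq).subset fun ν hν => ⟨support_subset_Icc hI hν, h0 ν hν⟩
  refine ⟨hI, fun A hA => ?_, hfin, ⟨f, fun j => (specProb hL (hF (hf j))).toFiniteMeasure, hf,
    fun j => rfl, ?_⟩, ?_⟩
  -- Symmetry passes to the limit because pushing forward by negation is weakly continuous.
  · have hc := (ProbabilityMeasure.continuous_map (Ω := ℝ) (f := fun x : ℝ => -x) continuous_neg).tendsto μ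
    have h1 := hc.comp hμ
    have h2 : ∀ j, (specProb hL (hF (hf j))).map (f := fun x : ℝ => -x) continuous_neg.aemeasurable =
        specProb hL (hF (hf j)) := by
      intro j
      apply Subtype.ext
      exact specMeasure_map_neg (hF (hf j))
    have h3 : μ.map (f := fun x : ℝ => -x) continuous_neg.aemeasurable = μ := by
      refine tendsto_nhds_unique h1 (hμ.congr fun j => ?_)
      exact (h2 j).symm
    have h4 := congrArg (fun ν : ProbabilityMeasure ℝ => (ν : Measure ℝ) A) h3
    simp only [ProbabilityMeasure.toMeasure_map] at h4
    rw [Measure.map_apply measurable_neg hA] at h4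
    exact h4
  · exact (ProbabilityMeasure.tendsto_nhds_iff_toFiniteMeasure_tendsto_nhds _).1 hμ
  · have hfin' := hfin.inter_of_left (Set.Icc 0 Real.pi)
    rw [ProbabilityMeasure.toMeasure_comp_toFiniteMeasure_eq_toMeasure,
      finsum_mem_eq_finite_toFinset_sum _ hfin']
    refine sum_kappa_add_kappaL_lt hL hx hx0 _ (fun γ hγ => ?_) fun γ hγ => ?_
    · exact (hfin'.mem_toFinset.1 hγ).2
    · rw [← normSqCirc_eq_zero]
      exact h0 γ (hfin'.mem_toFinset.1 hγ).1

end SizeControl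

namespace SizeControl
open MeasureTheory Polynomial Filter Topology

/-! ### Limits of normalized projected covariance matrices -/

variable {n : ℕ} {L : Submodule ℝ (EuclideanSpace ℝ (Fin n))}

theorem toLp_projPerp_mulVec (x : Fin n → ℝ) :
    WithLp.toLp 2 (projPerp L *ᵥ x) = Lᗮ.starProjection (WithLp.toLp 2 x) := by
  have h : WithLp.toLp 2 x = ∑ j, x j • EuclideanSpace.single j (1 : ℝ) := by
    ext i
    simp [Pi.single_apply]
  rw [h, map_sum]
  ext i
  simp [projPerp, Matrix.mulVec, dotProduct, mul_comm, Pi.single_apply]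

theorem projPerp_mulVec (x : EuclideanSpace ℝ (Fin n)) :
    projPerp L *ᵥ x.ofLp = (Lᗮ.starProjection x).ofLp := by
  rw [← toLp_projPerp_mulVec]

theorem projPerp_transpose : (projPerp L)ᵀ = projPerp L := by
  ext i j
  have h := Submodule.inner_starProjection_left_eq_right Lᗮ (EuclideanSpace.single i (1 : ℝ))
    (EuclideanSpace.single j (1 : ℝ))
  simpa [projPerp, EuclideanSpace.inner_single_left, EuclideanSpace.inner_single_right] using h

theorem projPerp_sandwich_quadratic (S : Matrix (Fin n) (Fin n) ℝ)
    (x : EuclideanSpace ℝ (Fin n)) :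
    x.ofLp ⬝ᵥ (projPerp L * S * projPerp L) *ᵥ x.ofLp =
      (Lᗮ.starProjection x).ofLp ⬝ᵥ S *ᵥ (Lᗮ.starProjection x).ofLp := by
  rw [← projPerp_mulVec, ← Matrix.mulVec_mulVec, ← Matrix.mulVec_mulVec, Matrix.dotProduct_mulVec,
    ← Matrix.mulVec_transpose, projPerp_transpose]

theorem normProj_quadratic (S : Matrix (Fin n) (Fin n) ℝ) (x : EuclideanSpace ℝ (Fin n)) :
    x.ofLp ⬝ᵥ normProj L S *ᵥ x.ofLp = (frob (projPerp L * S * projPerp L))⁻¹ *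
      ((Lᗮ.starProjection x).ofLp ⬝ᵥ S *ᵥ (Lᗮ.starProjection x).ofLp) := by
  rw [normProj, Matrix.smul_mulVec, dotProduct_smul, projPerp_sandwich_quadratic, smul_eq_mul]

theorem frob_smul (c : ℝ) (A : Matrix (Fin n) (Fin n) ℝ) : frob (c • A) = |c| * frob A := by
  unfold frob
  simp only [Matrix.smul_apply, smul_eq_mul, mul_pow, ← Finset.mul_sum]
  rw [Real.sqrt_mul (sq_nonneg c), Real.sqrt_sq_eq_abs]

theorem frob_nonneg (A : Matrix (Fin n) (Fin n) ℝ) : 0 ≤ frob A := Real.sqrt_nonneg _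

theorem frob_zero : frob (0 : Matrix (Fin n) (Fin n) ℝ) = 0 := by simp [frob]

theorem abs_apply_le_frob (A : Matrix (Fin n) (Fin n) ℝ) (i j : Fin n) : |A i j| ≤ frob A := by
  rw [frob, ← Real.sqrt_sq_eq_abs]
  refine Real.sqrt_le_sqrt ?_
  calc A i j ^ 2 ≤ ∑ j, A i j ^ 2 :=
        Finset.single_le_sum (f := fun j => A i j ^ 2) (fun _ _ => sq_nonneg _) (Finset.mem_univ j)
    _ ≤ ∑ i, ∑ j, A i j ^ 2 :=
        Finset.single_le_sum (f := fun i => ∑ j, A i j ^ 2)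
          (fun _ _ => Finset.sum_nonneg fun _ _ => sq_nonneg _) (Finset.mem_univ i)

theorem frob_pos {A : Matrix (Fin n) (Fin n) ℝ} (hA : A ≠ 0) : 0 < frob A := by
  refine (frob_nonneg A).lt_of_ne' fun h => hA ?_
  ext i j
  have := abs_apply_le_frob A i j
  rw [h] at this
  simpa using this

theorem continuous_frob : Continuous (frob : Matrix (Fin n) (Fin n) ℝ → ℝ) := by
  unfold frob
  refine Real.continuous_sqrt.comp ?_
  exact continuous_finsetSum _ fun i _ => continuous_finsetSum _ fun j _ =>
    (continuous_id.matrix_elem i j).pow 2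

theorem continuous_quadratic (x : Fin n → ℝ) :
    Continuous fun A : Matrix (Fin n) (Fin n) ℝ => x ⬝ᵥ A *ᵥ x :=
  continuous_const.dotProduct (continuous_id.matrix_mulVec continuous_const)

theorem projPerp_sandwich_ne_zero (hL : L ≠ ⊤) {f : ℝ → ℝ} (hf : f ∈ Fall) :
    projPerp L * Sig n f * projPerp L ≠ 0 := by
  intro h
  obtain ⟨x, hx, hx0⟩ := exists_orthogonal_ne_zero hL
  have h1 := projPerp_sandwich_quadratic (L := L) (Sig n f) x
  rw [h, Submodule.starProjection_eq_self_iff.2 hx] at h1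
  have h2 := Sig_quadratic_pos hf hx0
  simp [← h1] at h2

theorem frob_normProj (hL : L ≠ ⊤) {f : ℝ → ℝ} (hf : f ∈ Fall) :
    frob (normProj L (Sig n f)) = 1 := by
  have h := frob_pos (projPerp_sandwich_ne_zero hL hf)
  rw [normProj, frob_smul, abs_of_pos (inv_pos.2 h), inv_mul_cancel₀ h.ne']

theorem normProj_posSemidef {S : Matrix (Fin n) (Fin n) ℝ} (hS : S.PosSemidef) :
    (normProj L S).PosSemidef := by
  have h := hS.mul_mul_conjTranspose_same (projPerp L)
  rw [Matrix.conjTranspose_eq_transpose_of_trivial, projPerp_transpose] at h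
  exact h.smul (inv_nonneg.2 (frob_nonneg _))

theorem isClosed_posSemidef : IsClosed {A : Matrix (Fin n) (Fin n) ℝ | A.PosSemidef} := by
  have : {A : Matrix (Fin n) (Fin n) ℝ | A.PosSemidef} =
      {A | Aᵀ = A} ∩ ⋂ x : Fin n → ℝ, {A | 0 ≤ x ⬝ᵥ A *ᵥ x} := by
    ext A
    simp only [Set.mem_ofPred_eq, Set.mem_inter_iff, Set.mem_iInter,
      Matrix.posSemidef_iff_dotProduct_mulVec, star_trivial, Matrix.IsHermitian,
      Matrix.conjTranspose_eq_transpose_of_trivial]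
  rw [this]
  exact (isClosed_eq continuous_id.matrix_transpose continuous_id).inter
    (isClosed_iInter fun x => isClosed_le continuous_const (continuous_quadratic x))

/-- A matrix whose rank is small enough annihilates a nonzero vector orthogonal to `L`. -/
theorem exists_orthogonal_mulVec_eq_zero {A : Matrix (Fin n) (Fin n) ℝ}
    (h : A.rank + Module.finrank ℝ L < n) : ∃ x ∈ Lᗮ, x ≠ 0 ∧ A *ᵥ x.ofLp = 0 := by
  let g : Lᗮ →ₗ[ℝ] (Fin n → ℝ) :=
    A.mulVecLin ∘ₗ (WithLp.linearEquiv 2 ℝ (Fin n → ℝ)).toLinearMap ∘ₗ Lᗮ.subtype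
  have h1 := g.finrank_range_add_finrank_ker
  have h2 : Module.finrank ℝ (LinearMap.range g) ≤ A.rank :=
    Submodule.finrank_mono (LinearMap.range_comp_le_range _ _)
  have h3 := L.finrank_add_finrank_orthogonal
  rw [finrank_euclideanSpace_fin] at h3
  have h4 : LinearMap.ker g ≠ ⊥ := by
    intro h5
    rw [h5, finrank_bot] at h1
    omega
  obtain ⟨x, hx, hx0⟩ := Submodule.exists_mem_ne_zero_of_ne_bot h4
  exact ⟨x, x.2, by simpa using hx0, hx⟩

theorem mem_colSpan_orthogonal_iff {m : Type} [Fintype m] (A : Matrix (Fin n) m ℝ)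
    (x : EuclideanSpace ℝ (Fin n)) : x ∈ (colSpan A)ᗮ ↔ Aᵀ *ᵥ x.ofLp = 0 := by
  have h1 : x ∈ (colSpan A)ᗮ ↔ colSpan A ≤ (ℝ ∙ x)ᗮ := by
    simp only [SetLike.le_def, Submodule.mem_orthogonal_singleton_iff_inner_left]
    rfl
  rw [h1, colSpan, Submodule.span_le, funext_iff]
  simp only [Set.range_subset_iff, SetLike.mem_coe,
    Submodule.mem_orthogonal_singleton_iff_inner_left, PiLp.inner_apply, Matrix.mulVec, dotProduct]
  simp [mul_comm]

/-- The column space of a limit of normalized projected covariance matrices that is singular on the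
orthogonal complement of `L` contains, modulo `L`, the vectors belonging to the frequencies in some
element of `SS F L`. -/
theorem exists_mem_SS_colSpan_le (hL : L ≠ ⊤) {F : Set (ℝ → ℝ)} (hF : F ⊆ Fall) {f : ℕ → ℝ → ℝ}
    (hf : ∀ j, f j ∈ F) {A : Matrix (Fin n) (Fin n) ℝ}
    (hA : Tendsto (fun j => normProj L (Sig n (f j))) atTop (𝓝 A))
    (hr : A.rank + Module.finrank ℝ L < n) :
    ∃ Γ ∈ SS F L, ∀ γ ∈ Γ, colSpan (Erho L γ) ≤ colSpan A ⊔ L := by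
  obtain ⟨μ, φ, hφ, hμ, hI⟩ := specProb_tendsto_subseq hL fun j => hF (hf j)
  replace hA := hA.comp hφ.tendsto_atTop
  have hpsd : A.PosSemidef := isClosed_posSemidef.mem_of_tendsto hA
    (Eventually.of_forall fun j => normProj_posSemidef (Sig_posSemidef (hF (hf _))))
  have hfrob : frob A = 1 := by
    refine tendsto_nhds_unique ((continuous_frob.tendsto A).comp hA) ?_
    refine tendsto_const_nhds.congr fun j => ?_
    exact (frob_normProj hL (hF (hf _))).symm
  let I : EuclideanSpace ℝ (Fin n) → ℝ := fun x =>
    ∫ ν, normSqCirc (quotPoly L x) ν ∂(μ : Measure ℝ)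
  let a : ℕ → ℝ := fun j =>
    (frob (projPerp L * Sig n (f (φ j)) * projPerp L))⁻¹ *
      ∫ ν in Set.Icc (-Real.pi) Real.pi, filtered L (f (φ j)) ν
  have hquad : ∀ x ∈ Lᗮ, ∀ j, x.ofLp ⬝ᵥ normProj L (Sig n (f (φ j))) *ᵥ x.ofLp =
      a j * ∫ ν, normSqCirc (quotPoly L x) ν ∂(specProb hL (hF (hf (φ j))) : Measure ℝ) := by
    intro x hx j
    rw [normProj_quadratic, Submodule.starProjection_eq_self_iff.2 hx,
      Sig_quadratic_eq_integral_specMeasure hL (hF (hf _)) hx, ← mul_assoc]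
    rfl
  have hlim : ∀ x : EuclideanSpace ℝ (Fin n),
      Tendsto (fun j => x.ofLp ⬝ᵥ normProj L (Sig n (f (φ j))) *ᵥ x.ofLp) atTop
        (𝓝 (x.ofLp ⬝ᵥ A *ᵥ x.ofLp)) := fun x =>
    ((continuous_quadratic x.ofLp).tendsto A).comp hA
  obtain ⟨x₀, hx₀, hpos⟩ := exists_integral_normSqCirc_pos hL hI
  -- The scalars are recovered as a ratio of convergent sequences at one `x₀` whose limiting
  -- integral is positive.
  have ha : Tendsto a atTop (𝓝 ((x₀.ofLp ⬝ᵥ A *ᵥ x₀.ofLp) / I x₀)) := by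
    have h1 := tendsto_integral_normSqCirc hμ (quotPoly L x₀)
    refine ((hlim x₀).div h1 hpos.ne').congr' ?_
    filter_upwards [h1.eventually_ne hpos.ne'] with j hj
    rw [Pi.div_apply, hquad x₀ hx₀, mul_div_assoc, div_self hj, mul_one]
  set a' := (x₀.ofLp ⬝ᵥ A *ᵥ x₀.ofLp) / I x₀ with ha'
  have hAq : ∀ x ∈ Lᗮ, x.ofLp ⬝ᵥ A *ᵥ x.ofLp = a' * I x := by
    intro x hx
    refine tendsto_nhds_unique (hlim x) ?_
    exact (ha.mul (tendsto_integral_normSqCirc hμ (quotPoly L x))).congr fun j =>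
      (hquad x hx j).symm
  -- A zero scalar would kill the limit form on `Lᗮ`, hence everywhere, against `frob A = 1`.
  have ha0 : a' ≠ 0 := by
    intro h0
    have h1 : ∀ x : EuclideanSpace ℝ (Fin n), x.ofLp ⬝ᵥ A *ᵥ x.ofLp = 0 := by
      intro x
      have h2 : x.ofLp ⬝ᵥ A *ᵥ x.ofLp =
          (Lᗮ.starProjection x).ofLp ⬝ᵥ A *ᵥ (Lᗮ.starProjection x).ofLp := by
        refine tendsto_nhds_unique (hlim x) ((hlim (Lᗮ.starProjection x)).congr fun j => ?_)
        rw [normProj_quadratic, normProj_quadratic, Submodule.starProjection_eq_self_iff.2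
          (Submodule.starProjection_apply_mem _ _)]
      rw [h2, hAq _ (Submodule.starProjection_apply_mem _ _), h0, zero_mul]
    have h3 : A = 0 := by
      ext i j
      have h4 := (hpsd.dotProduct_mulVec_zero_iff (Pi.single j 1)).1
        (h1 (WithLp.toLp 2 (Pi.single j 1)))
      simpa using congrFun h4 i
    rw [h3, frob_zero] at hfrob
    exact zero_ne_one hfrob
  have hI0 : ∀ x ∈ Lᗮ, A *ᵥ x.ofLp = 0 → I x = 0 := by
    intro x hx h
    have h1 := hAq x hx
    rw [h, dotProduct_zero] at h1
    exact (mul_eq_zero.1 h1.symm).resolve_left ha0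
  obtain ⟨x, hx, hx0, hAx⟩ := exists_orthogonal_mulVec_eq_zero hr
  refine ⟨_, ⟨μ.toFiniteMeasure, mem_MM hL hF (fun j => hf (φ j)) hμ hI hx hx0 (hI0 x hx hAx),
    rfl⟩, fun γ hγ => ?_⟩
  refine le_trans ?_ (Submodule.orthogonal_orthogonal (colSpan A ⊔ L)).le
  -- Dually, a `y` in `Lᗮ` orthogonal to `colSpan A` is killed by the symmetric `A`, so its quotient
  -- vanishes on the whole support.
  rw [Submodule.le_orthogonal_iff_le_orthogonal, ← Submodule.inf_orthogonal]
  rintro y ⟨hy1, hy2⟩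
  have hAy : A *ᵥ y.ofLp = 0 := by
    have h1 := (mem_colSpan_orthogonal_iff A y).1 hy1
    rwa [← Matrix.conjTranspose_eq_transpose_of_trivial, hpsd.isHermitian.eq] at h1
  have h2 := (integral_normSqCirc_eq_zero_iff μ (quotPoly L y)).1 (hI0 y hy2 hAy)
  refine mem_orthogonal_Erho hL hy2 hγ.2 ?_
  rw [← normSqCirc_eq_zero]
  exact h2 γ hγ.1

end SizeControl

namespace SizeControl
open MeasureTheory Filter Topology ProbabilityTheory
open Matrix (toEuclideanCLM)
open scoped MatrixOrder

/-! ### Rejection probabilities as functions of a root of the covariance matrix -/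

variable {n k q : ℕ} {X : Matrix (Fin n) (Fin k) ℝ} {R : Matrix (Fin q) (Fin k) ℝ}
  {r : Fin q → ℝ} {w : ℤ → ℝ} {F : Set (ℝ → ℝ)}

theorem colSpan_ne_top (hkn : k < n) (X : Matrix (Fin n) (Fin k) ℝ) : colSpan X ≠ ⊤ := by
  intro h
  have h1 : Module.finrank ℝ (colSpan X) ≤ Fintype.card (Fin k) := finrank_range_le_card _
  rw [h, finrank_top, finrank_euclideanSpace_fin, Fintype.card_fin] at h1
  omega

theorem M0lin_ne_top (hkn : k < n) : M0lin X R ≠ ⊤ := fun h =>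
  colSpan_ne_top hkn X (top_le_iff.1 (h ▸ M0lin_le_colSpan))

theorem M0_nonempty (hR : R.rank = q) : (M0 X R r).Nonempty := by
  have h1 : LinearMap.range R.mulVecLin = ⊤ := by
    refine Submodule.eq_top_of_finrank_eq ?_
    rw [Module.finrank_fintype_fun_eq_card, Fintype.card_fin]
    exact hR
  obtain ⟨β, hβ⟩ : r ∈ LinearMap.range R.mulVecLin := h1 ▸ Submodule.mem_top
  exact ⟨_, β, rfl, hβ⟩

/-- A root of `normProj L S`. -/
noncomputable def covRoot (L : Submodule ℝ (EuclideanSpace ℝ (Fin n)))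
    (S : Matrix (Fin n) (Fin n) ℝ) : Matrix (Fin n) (Fin n) ℝ :=
  (Real.sqrt (frob (projPerp L * S * projPerp L)))⁻¹ • (projPerp L * CFC.sqrt S)

theorem covRoot_mul_transpose {L : Submodule ℝ (EuclideanSpace ℝ (Fin n))}
    {S : Matrix (Fin n) (Fin n) ℝ} (hS : S.PosSemidef) :
    covRoot L S * (covRoot L S)ᵀ = normProj L S := by
  have h1 : (CFC.sqrt S)ᵀ = CFC.sqrt S := by
    rw [← Matrix.conjTranspose_eq_transpose_of_trivial]
    exact (CFC.sqrt_nonneg S).isSelfAdjoint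
  have h2 : CFC.sqrt S * CFC.sqrt S = S := CFC.sqrt_mul_sqrt_self _ hS.nonneg
  have h3 : projPerp L * CFC.sqrt S * (CFC.sqrt S * projPerp L) = projPerp L * S * projPerp L := by
    rw [← Matrix.mul_assoc, Matrix.mul_assoc (projPerp L), h2]
  rw [covRoot, Matrix.transpose_smul, Matrix.transpose_mul, h1, projPerp_transpose,
    Matrix.smul_mul, Matrix.mul_smul, smul_smul, h3, ← mul_inv, Real.mul_self_sqrt (frob_nonneg _),
    normProj]

theorem projPerp_sandwich_smul (L : Submodule ℝ (EuclideanSpace ℝ (Fin n))) (c : ℝ)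
    (S : Matrix (Fin n) (Fin n) ℝ) :
    projPerp L * (c • S) * projPerp L = c • (projPerp L * S * projPerp L) := by
  rw [Matrix.mul_smul, Matrix.smul_mul]

theorem normProj_smul (L : Submodule ℝ (EuclideanSpace ℝ (Fin n))) {c : ℝ} (hc : 0 < c)
    (S : Matrix (Fin n) (Fin n) ℝ) : normProj L (c • S) = normProj L S := by
  rw [normProj, normProj, projPerp_sandwich_smul, frob_smul, abs_of_pos hc, smul_smul, mul_inv,
    mul_assoc, mul_comm (frob _)⁻¹, ← mul_assoc, inv_mul_cancel₀ hc.ne', one_mul]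

/-- The roots of the normalized projected covariance matrices. -/
def roots (L : Submodule ℝ (EuclideanSpace ℝ (Fin n))) (F : Set (ℝ → ℝ)) :
    Set (Matrix (Fin n) (Fin n) ℝ) :=
  {G | ∃ σ2 ∈ Set.Ioi (0 : ℝ), ∃ f ∈ F, G = covRoot L (σ2 • Sig n f)}

theorem exists_of_mem_roots {L : Submodule ℝ (EuclideanSpace ℝ (Fin n))} (hF : F ⊆ Fall)
    {G : Matrix (Fin n) (Fin n) ℝ} (hG : G ∈ roots L F) :
    ∃ f ∈ F, G * Gᵀ = normProj L (Sig n f) := by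
  obtain ⟨σ2, hσ, f, hf, rfl⟩ := hG
  refine ⟨f, hf, ?_⟩
  rw [covRoot_mul_transpose ((Sig_posSemidef (hF hf)).smul hσ.le), normProj_smul _ hσ]

/-- Projecting subtracts an element of `M0lin X R` and normalizing rescales by a nonzero number; the
statistic sees neither. -/
theorem Tw_zero_covRoot (hn : n ≠ 0) (hX : X.rank = k) {S : Matrix (Fin n) (Fin n) ℝ}
    (hS : projPerp (M0lin X R) * S * projPerp (M0lin X R) ≠ 0) (z : EuclideanSpace ℝ (Fin n)) :
    Tw w X R 0 (toEuclideanCLM (𝕜 := ℝ) (covRoot (M0lin X R) S) z) =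
      Tw w X R 0 (toEuclideanCLM (𝕜 := ℝ) (CFC.sqrt S) z) := by
  set v := toEuclideanCLM (𝕜 := ℝ) (CFC.sqrt S) z with hv
  have h1 : toEuclideanCLM (𝕜 := ℝ) (covRoot (M0lin X R) S) z =
      (Real.sqrt (frob (projPerp (M0lin X R) * S * projPerp (M0lin X R))))⁻¹ •
        ((M0lin X R)ᗮ.starProjection v) := by
    rw [covRoot, map_smul, _root_.smul_apply, map_mul, mul_apply_eq_comp,
      ← hv]
    congr 1
    exact toLp_projPerp_mulVec v.ofLp
  have h2 : v = (M0lin X R).starProjection v + (M0lin X R)ᗮ.starProjection v :=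
    (Submodule.starProjection_add_starProjection_orthogonal _).symm
  rw [h1, Tw_zero_smul hn (inv_ne_zero (Real.sqrt_pos.2 (frob_pos hS)).ne')]
  conv_rhs => rw [h2]
  exact (Tw_zero_add_of_mem_M0lin hn hX (Submodule.starProjection_apply_mem _ _) _).symm

theorem measurable_Tw (hn : n ≠ 0) (hX : X.rank = k) {μ₀ : EuclideanSpace ℝ (Fin n)}
    (hμ₀ : μ₀ ∈ M0 X R r) : Measurable (Tw w X R r) := by
  have : Tw w X R r = fun y => Tw w X R 0 (y - μ₀) := by
    ext y
    rw [← Tw_add_of_mem_M0 hn hX hμ₀, add_sub_cancel]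
  rw [this]
  exact (measurable_Tw_zero hn).comp (measurable_id.sub_const _)

theorem multivariateGaussian_apply (μ : EuclideanSpace ℝ (Fin n)) (S : Matrix (Fin n) (Fin n) ℝ)
    {s : Set (EuclideanSpace ℝ (Fin n))} (hs : MeasurableSet s) :
    multivariateGaussian μ S s = stdGaussian (EuclideanSpace ℝ (Fin n))
      {z | μ + toEuclideanCLM (𝕜 := ℝ) (CFC.sqrt S) z ∈ s} :=
  Measure.map_apply (by fun_prop) hs

theorem size_eq_iSup_roots (hkn : k < n) (hX : X.rank = k) (hR : R.rank = q) (hF : F ⊆ Fall)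
    (C : ℝ) : size (M0 X R r) F (Tw w X R r) C = ⨆ G ∈ roots (M0lin X R) F,
      stdGaussian (EuclideanSpace ℝ (Fin n))
        {z | C ≤ Tw w X R 0 (toEuclideanCLM (𝕜 := ℝ) G z)} := by
  have hn : n ≠ 0 := by omega
  have key : ∀ μ₀ ∈ M0 X R r, ∀ σ2 ∈ Set.Ioi (0 : ℝ), ∀ f ∈ F,
      multivariateGaussian μ₀ (σ2 • Sig n f) {y | C ≤ Tw w X R r y} =
        stdGaussian (EuclideanSpace ℝ (Fin n))
          {z | C ≤ Tw w X R 0 (toEuclideanCLM (𝕜 := ℝ)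
            (covRoot (M0lin X R) (σ2 • Sig n f)) z)} := by
    intro μ₀ hμ₀ σ2 hσ f hf
    have hne : projPerp (M0lin X R) * (σ2 • Sig n f) * projPerp (M0lin X R) ≠ 0 := by
      rw [projPerp_sandwich_smul]
      exact smul_ne_zero hσ.ne' (projPerp_sandwich_ne_zero (M0lin_ne_top hkn) (hF hf))
    rw [multivariateGaussian_apply _ _
      (measurableSet_le measurable_const (measurable_Tw hn hX hμ₀))]
    refine congrArg _ (Set.ext fun z => ?_)
    rw [Set.mem_ofPred_eq, Set.mem_ofPred_eq, Set.mem_ofPred_eq, Tw_add_of_mem_M0 hn hX hμ₀,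
      Tw_zero_covRoot hn hX hne]
  obtain ⟨μ, hμ⟩ := M0_nonempty (X := X) (r := r) hR
  refine le_antisymm ?_ ?_
  · refine iSup₂_le fun μ₀ hμ₀ => iSup₂_le fun σ2 hσ => iSup₂_le fun f hf => ?_
    rw [key μ₀ hμ₀ σ2 hσ f hf]
    exact le_iSup₂_of_le _ ⟨σ2, hσ, f, hf, rfl⟩ le_rfl
  · refine iSup₂_le ?_
    rintro _ ⟨σ2, hσ, f, hf, rfl⟩
    rw [← key μ hμ σ2 hσ f hf]
    exact le_iSup₂_of_le μ hμ (le_iSup₂_of_le σ2 hσ (le_iSup₂_of_le f hf le_rfl))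

/-! ### Null sets of the test statistic -/

theorem mem_colSpan_iff_toEuclideanCLM {G : Matrix (Fin n) (Fin n) ℝ}
    {y : EuclideanSpace ℝ (Fin n)} :
    y ∈ colSpan G ↔ ∃ z, y = toEuclideanCLM (𝕜 := ℝ) G z := by
  rw [mem_colSpan_iff]
  exact ⟨fun ⟨β, h⟩ => ⟨WithLp.toLp 2 β, h⟩, fun ⟨z, h⟩ => ⟨z.ofLp, h⟩⟩

theorem colSpan_mul_transpose_le (G : Matrix (Fin n) (Fin n) ℝ) :
    colSpan (G * Gᵀ) ≤ colSpan G := by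
  intro y hy
  obtain ⟨β, rfl⟩ := mem_colSpan_iff.1 hy
  exact mem_colSpan_iff.2 ⟨Gᵀ *ᵥ β, by rw [Matrix.mulVec_mulVec]⟩

theorem uHat_add_of_mem_M0lin (hX : X.rank = k) (y : EuclideanSpace ℝ (Fin n))
    {v : EuclideanSpace ℝ (Fin n)} (hv : v ∈ M0lin X R) : uHat X (y + v) = uHat X y :=
  uHat_add_of_mem_colSpan hX y (M0lin_le_colSpan hv)

theorem numer_add_of_mem_M0lin (hn : n ≠ 0) (hX : X.rank = k) (y : EuclideanSpace ℝ (Fin n))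
    {v : EuclideanSpace ℝ (Fin n)} (hv : v ∈ M0lin X R) :
    numer w X R (y + v) = numer w X R y := by
  have h1 : omegaHat w X R (y + v) = omegaHat w X R y :=
    omegaHat_congr hn (uHat_add_of_mem_M0lin hX y hv)
  obtain ⟨β, rfl, hβ⟩ := hv
  have h2 : R *ᵥ betaHat X (y + WithLp.toLp 2 (X *ᵥ β)) = R *ᵥ betaHat X y := by
    rw [← betaHatLin_apply, map_add, betaHatLin_apply, betaHatLin_apply, betaHat_toLp hX,
      Matrix.mulVec_add, hβ, add_zero]
  rw [numer, numer, h1, h2]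

theorem polyFun_comp_toEuclideanCLM {h : EuclideanSpace ℝ (Fin n) → ℝ} (hh : h ∈ polyFun _)
    (G : Matrix (Fin n) (Fin n) ℝ) :
    (fun z => h (toEuclideanCLM (𝕜 := ℝ) G z)) ∈ polyFun (EuclideanSpace ℝ (Fin n)) := by
  simpa using polyFun_comp_affine hh 0 (toEuclideanCLM (𝕜 := ℝ) G).toLinearMap

/-- The polynomial function whose zeros are, outside of the zeros of the denominator, the points
where the test statistic equals `c`. -/
noncomputable def levelFun (w : ℤ → ℝ) (X : Matrix (Fin n) (Fin k) ℝ)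
    (R : Matrix (Fin q) (Fin k) ℝ) (c : ℝ) (y : EuclideanSpace ℝ (Fin n)) : ℝ :=
  numer w X R y - c * denom w X R y

theorem polyFun_levelFun (hn : n ≠ 0) (c : ℝ) :
    levelFun w X R c ∈ polyFun (EuclideanSpace ℝ (Fin n)) :=
  sub_mem (polyFun_numer hn) (Subalgebra.smul_mem _ (polyFun_denom hn) c)

theorem levelFun_eq_zero_iff {c : ℝ} {y : EuclideanSpace ℝ (Fin n)} (hy : denom w X R y ≠ 0) :
    levelFun w X R c y = 0 ↔ Tw w X R 0 y = c := by
  rw [Tw_zero_eq, div_eq_iff hy, levelFun, sub_eq_zero]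

theorem exists_root_of_sup {G : Matrix (Fin n) (Fin n) ℝ} {y : EuclideanSpace ℝ (Fin n)}
    (hy : y ∈ colSpan G ⊔ M0lin X R) :
    ∃ z, ∃ l ∈ M0lin X R, y = toEuclideanCLM (𝕜 := ℝ) G z + l := by
  obtain ⟨s, hs, l, hl, rfl⟩ := Submodule.mem_sup.1 hy
  obtain ⟨z, rfl⟩ := mem_colSpan_iff_toEuclideanCLM.1 hs
  exact ⟨z, l, hl, rfl⟩

/-- Translation by `M0lin X R` leaves the denominator unchanged, so one good point of the sum yields
one of the form `Gz`, and a polynomial function nonzero at one point is almost surely nonzero. -/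
theorem ae_denom_ne_zero (hn : n ≠ 0) (hX : X.rank = k) (hw : AssumptionAW n w)
    {G : Matrix (Fin n) (Fin n) ℝ} {y : EuclideanSpace ℝ (Fin n)}
    (hy : y ∈ colSpan G ⊔ M0lin X R) (hyB : y ∉ Bset X R) :
    ∀ᵐ z ∂stdGaussian (EuclideanSpace ℝ (Fin n)),
      denom w X R (toEuclideanCLM (𝕜 := ℝ) G z) ≠ 0 := by
  obtain ⟨z, l, hl, rfl⟩ := exists_root_of_sup hy
  refine polyFun_ae_stdGaussian_ne_zero (polyFun_comp_toEuclideanCLM (polyFun_denom hn) G)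
    (a := z) ?_
  rw [← denom_congr hn (uHat_add_of_mem_M0lin hX _ hl)]
  exact denom_ne_zero hn hw hyB

theorem levelFun_add_of_mem_M0lin (hn : n ≠ 0) (hX : X.rank = k) (c : ℝ)
    (y : EuclideanSpace ℝ (Fin n)) {v : EuclideanSpace ℝ (Fin n)} (hv : v ∈ M0lin X R) :
    levelFun w X R c (y + v) = levelFun w X R c y := by
  rw [levelFun, levelFun, numer_add_of_mem_M0lin hn hX y hv,
    denom_congr hn (uHat_add_of_mem_M0lin hX y hv)]

theorem ae_Tw_ne (hn : n ≠ 0) (hX : X.rank = k) {G : Matrix (Fin n) (Fin n) ℝ}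
    (hd : ∀ᵐ z ∂stdGaussian (EuclideanSpace ℝ (Fin n)),
      denom w X R (toEuclideanCLM (𝕜 := ℝ) G z) ≠ 0) {c : ℝ} {y : EuclideanSpace ℝ (Fin n)}
    (hy : y ∈ colSpan G ⊔ M0lin X R) (hyc : levelFun w X R c y ≠ 0) :
    ∀ᵐ z ∂stdGaussian (EuclideanSpace ℝ (Fin n)),
      Tw w X R 0 (toEuclideanCLM (𝕜 := ℝ) G z) ≠ c := by
  obtain ⟨z, l, hl, rfl⟩ := exists_root_of_sup hy
  rw [levelFun_add_of_mem_M0lin hn hX c _ hl] at hyc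
  filter_upwards [hd, polyFun_ae_stdGaussian_ne_zero
    (polyFun_comp_toEuclideanCLM (polyFun_levelFun hn c) G) (a := z) hyc] with z h1 h2
  rwa [Ne, levelFun_eq_zero_iff h1] at h2

/-- This makes `c` one of the constants over which `Cstar` is the supremum. -/
theorem ae_lebAffine_Tw_eq (hn : n ≠ 0) (hX : X.rank = k) (hw : AssumptionAW n w)
    {S : Submodule ℝ (EuclideanSpace ℝ (Fin n))} {y : EuclideanSpace ℝ (Fin n)}
    (hy : y ∈ S ⊔ M0lin X R) (hyB : y ∉ Bset X R) {c : ℝ}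
    (hc : ∀ s ∈ S, levelFun w X R c s = 0) {μ₀ : EuclideanSpace ℝ (Fin n)}
    (hμ₀ : μ₀ ∈ M0 X R r) : ∀ᵐ y ∂lebAffine μ₀ S, Tw w X R r y = c := by
  rw [lebAffine, ae_map_iff (by fun_prop)
    (measurableSet_eq_fun (measurable_Tw hn hX hμ₀) measurable_const)]
  obtain ⟨s, hs, l, hl, rfl⟩ := Submodule.mem_sup.1 hy
  have h1 : denom w X R s ≠ 0 := by
    rw [← denom_congr hn (uHat_add_of_mem_M0lin hX _ hl)]
    exact denom_ne_zero hn hw hyB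
  have h2 : (fun x : S => denom w X R (0 + S.subtype x)) ∈ polyFun S :=
    polyFun_comp_affine (polyFun_denom hn) 0 S.subtype
  filter_upwards [polyFun_ae_ne_zero h2 (a := ⟨s, hs⟩) (by simpa using h1) _] with x hx
  rw [Tw_add_of_mem_M0 hn hX hμ₀, ← levelFun_eq_zero_iff (by simpa using hx)]
  exact hc x x.2

/-! ### Limits of sequences of roots -/

/-- The squared norm of row `i` is a diagonal entry of `G * Gᵀ`, whose Frobenius norm is one. -/
theorem root_apply_mem_Icc {L : Submodule ℝ (EuclideanSpace ℝ (Fin n))} (hL : L ≠ ⊤)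
    (hF : F ⊆ Fall) {G : Matrix (Fin n) (Fin n) ℝ} (hG : G ∈ roots L F) (i j : Fin n) :
    G i j ∈ Set.Icc (-1 : ℝ) 1 := by
  obtain ⟨f, hf, h⟩ := exists_of_mem_roots hF hG
  have h1 := abs_apply_le_frob (normProj L (Sig n f)) i i
  rw [frob_normProj hL (hF hf), ← h, Matrix.mul_apply] at h1
  have h2 : G i j ^ 2 ≤ ∑ l, G i l * Gᵀ l i := by
    simp only [Matrix.transpose_apply, ← sq]
    exact Finset.single_le_sum (f := fun l => G i l ^ 2) (fun _ _ => sq_nonneg _)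
      (Finset.mem_univ j)
  exact abs_le.1 ((sq_le_one_iff_abs_le_one _).1 (h2.trans ((le_abs_self _).trans h1)))

theorem roots_tendsto_subseq {L : Submodule ℝ (EuclideanSpace ℝ (Fin n))} (hL : L ≠ ⊤)
    (hF : F ⊆ Fall) {G : ℕ → Matrix (Fin n) (Fin n) ℝ} (hG : ∀ j, G j ∈ roots L F) :
    ∃ (G' : Matrix (Fin n) (Fin n) ℝ) (φ : ℕ → ℕ), StrictMono φ ∧
      Tendsto (fun j => G (φ j)) atTop (𝓝 G') := by
  have hc : IsCompact (Set.univ.pi fun _ : Fin n => Set.univ.pi fun _ : Fin n =>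
      Set.Icc (-1 : ℝ) 1) := isCompact_univ_pi fun _ => isCompact_univ_pi fun _ => isCompact_Icc
  obtain ⟨G', -, φ, hφ, h⟩ := IsCompact.tendsto_subseq (X := Fin n → Fin n → ℝ) hc (x := G) fun j i _ l _ =>
    root_apply_mem_Icc hL hF (hG j) i l
  exact ⟨G', φ, hφ, h⟩

theorem normProj_mulVec_of_mem {L : Submodule ℝ (EuclideanSpace ℝ (Fin n))}
    (S : Matrix (Fin n) (Fin n) ℝ) {x : EuclideanSpace ℝ (Fin n)} (hx : x ∈ L) :
    normProj L S *ᵥ x.ofLp = 0 := by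
  have h : Lᗮ.starProjection x = 0 := by
    rw [Submodule.starProjection_apply_eq_zero_iff]
    exact Submodule.le_orthogonal_orthogonal L hx
  rw [normProj, Matrix.smul_mulVec, ← Matrix.mulVec_mulVec, projPerp_mulVec, h]
  simp

/-- The kernel of `A` strictly contains `L`; apply rank-nullity. -/
theorem rank_add_finrank_lt {A : Matrix (Fin n) (Fin n) ℝ}
    {L : Submodule ℝ (EuclideanSpace ℝ (Fin n))} (hA : ∀ x ∈ L, A *ᵥ x.ofLp = 0)
    {x : EuclideanSpace ℝ (Fin n)} (hx : x ∈ Lᗮ) (hx0 : x ≠ 0) (hAx : A *ᵥ x.ofLp = 0) :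
    A.rank + Module.finrank ℝ L < n := by
  let e := (WithLp.linearEquiv 2 ℝ (Fin n → ℝ))
  let g : EuclideanSpace ℝ (Fin n) →ₗ[ℝ] (Fin n → ℝ) := A.mulVecLin ∘ₗ e.toLinearMap
  have h1 := g.finrank_range_add_finrank_ker
  rw [finrank_euclideanSpace_fin, LinearMap.range_comp_of_range_eq_top _ e.range] at h1
  have h2 : L < LinearMap.ker g := by
    refine lt_of_le_of_ne (fun y hy => hA y hy) fun h => hx0 ?_
    have h3 : x ∈ L := h ▸ (show x ∈ LinearMap.ker g from hAx)
    exact inner_self_eq_zero.1 (hx x h3)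
  have h3 := Submodule.finrank_lt_finrank_of_lt h2
  rw [Matrix.rank]
  omega

theorem sup_eq_top_of_forall {A : Matrix (Fin n) (Fin n) ℝ} (hA : A.PosSemidef)
    {L : Submodule ℝ (EuclideanSpace ℝ (Fin n))}
    (h : ∀ x ∈ Lᗮ, A *ᵥ x.ofLp = 0 → x = 0) : colSpan A ⊔ L = ⊤ := by
  rw [← Submodule.orthogonal_eq_bot_iff, ← Submodule.inf_orthogonal, eq_bot_iff]
  rintro x ⟨hx1, hx2⟩
  refine h x hx2 ?_
  have h1 := (mem_colSpan_orthogonal_iff A x).1 hx1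
  rwa [← Matrix.conjTranspose_eq_transpose_of_trivial, hA.isHermitian.eq] at h1

/-- `Sig n f` is positive definite, so degeneracy on the orthogonal complement can arise only in
limits. -/
theorem colSpan_root_sup_eq_top (hkn : k < n) (hF : F ⊆ Fall) {G : Matrix (Fin n) (Fin n) ℝ}
    (hG : G ∈ roots (M0lin X R) F) : colSpan G ⊔ M0lin X R = ⊤ := by
  obtain ⟨f, hf, h⟩ := exists_of_mem_roots hF hG
  have h1 : colSpan (normProj (M0lin X R) (Sig n f)) ⊔ M0lin X R = ⊤ := by
    refine sup_eq_top_of_forall (normProj_posSemidef (Sig_posSemidef (hF hf))) fun x hx h0 => ?_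
    by_contra hne
    have h2 := normProj_quadratic (L := M0lin X R) (Sig n f) x
    rw [h0, dotProduct_zero, Submodule.starProjection_eq_self_iff.2 hx] at h2
    have h3 := frob_pos (projPerp_sandwich_ne_zero (M0lin_ne_top hkn (X := X) (R := R)) (hF hf))
    exact (mul_pos (inv_pos.2 h3) (Sig_quadratic_pos (hF hf) hne)).ne h2
  rw [eq_top_iff, ← h1, ← h]
  exact sup_le_sup_right (colSpan_mul_transpose_le G) _

theorem ae_Tw_root_ne (hkn : k < n) (hq : 1 ≤ q) (hX : X.rank = k) (hR : R.rank = q)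
    (hw : AssumptionAW n w) (hRX : AssumptionRX X R) (hF : F ⊆ Fall)
    {G : Matrix (Fin n) (Fin n) ℝ} (hG : G ∈ roots (M0lin X R) F) (c : ℝ) :
    ∀ᵐ z ∂stdGaussian (EuclideanSpace ℝ (Fin n)),
      Tw w X R 0 (toEuclideanCLM (𝕜 := ℝ) G z) ≠ c := by
  have hn : n ≠ 0 := by omega
  have htop := colSpan_root_sup_eq_top hkn hF hG
  obtain ⟨y₀, hy₀⟩ := exists_notMem_Bset hRX
  obtain ⟨y, hy⟩ := exists_numer_ne (w := w) hn hq hX hR hw hRX c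
  exact ae_Tw_ne hn hX (ae_denom_ne_zero hn hX hw (htop ▸ Submodule.mem_top) hy₀)
    (htop ▸ Submodule.mem_top) hy

/-- The condition that no `Γ` in `SS F L` has its associated vectors inside of `Bset X R`. -/
def AvoidsB (X : Matrix (Fin n) (Fin k) ℝ) (R : Matrix (Fin q) (Fin k) ℝ) (F : Set (ℝ → ℝ)) :
    Prop :=
  ∀ Γ ∈ SS F (M0lin X R), ∀ W : Submodule ℝ (EuclideanSpace ℝ (Fin n)),
    (∀ γ ∈ Γ, colSpan (Erho (M0lin X R) γ) ≤ W) → ∃ y ∈ W, y ∉ Bset X R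

/-- The compactness statement behind both the size bound and left continuity: the denominator
survives in the limit, and levels above `Cstar` are not atoms there. -/
theorem exists_limit_root (hkn : k < n) (hq : 1 ≤ q) (hX : X.rank = k) (hR : R.rank = q)
    (hw : AssumptionAW n w) (hRX : AssumptionRX X R) (hF : F ⊆ Fall) (hB : AvoidsB X R F)
    {G : ℕ → Matrix (Fin n) (Fin n) ℝ} (hG : ∀ j, G j ∈ roots (M0lin X R) F) :
    ∃ (G' : Matrix (Fin n) (Fin n) ℝ) (φ : ℕ → ℕ), StrictMono φ ∧
      Tendsto (fun j => G (φ j)) atTop (𝓝 G') ∧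
      (∀ᵐ z ∂stdGaussian (EuclideanSpace ℝ (Fin n)),
        denom w X R (toEuclideanCLM (𝕜 := ℝ) G' z) ≠ 0) ∧
      ∀ c : ℝ, Cstar (M0 X R r) (M0lin X R) F (Tw w X R r) < (c : EReal) →
        ∀ᵐ z ∂stdGaussian (EuclideanSpace ℝ (Fin n)),
          Tw w X R 0 (toEuclideanCLM (𝕜 := ℝ) G' z) ≠ c := by
  have hn : n ≠ 0 := by omega
  have hL : M0lin X R ≠ ⊤ := M0lin_ne_top hkn
  obtain ⟨G', φ, hφ, hlim⟩ := roots_tendsto_subseq hL hF hG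
  choose f hf hfG using fun j => exists_of_mem_roots hF (hG j)
  set A := G' * G'ᵀ with hA
  have hAlim : Tendsto (fun j => normProj (M0lin X R) (Sig n (f (φ j)))) atTop (𝓝 A) := by
    have h1 : Continuous fun G : Matrix (Fin n) (Fin n) ℝ => G * Gᵀ :=
      continuous_id.matrix_mul continuous_id.matrix_transpose
    exact ((h1.tendsto G').comp hlim).congr fun j => hfG (φ j)
  have hpsd : A.PosSemidef := isClosed_posSemidef.mem_of_tendsto hAlim
    (Eventually.of_forall fun j => normProj_posSemidef (Sig_posSemidef (hF (hf _))))
  have hAL : ∀ x ∈ M0lin X R, A *ᵥ x.ofLp = 0 := by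
    intro x hx
    have h1 : Continuous fun A : Matrix (Fin n) (Fin n) ℝ => A *ᵥ x.ofLp :=
      continuous_id.matrix_mulVec continuous_const
    refine tendsto_nhds_unique ((h1.tendsto A).comp hAlim) (tendsto_const_nhds.congr fun j => ?_)
    exact (normProj_mulVec_of_mem _ hx).symm
  have hsub : colSpan A ⊔ M0lin X R ≤ colSpan G' ⊔ M0lin X R :=
    sup_le_sup_right (colSpan_mul_transpose_le G') _
  refine ⟨G', φ, hφ, hlim, ?_⟩
  -- Dichotomy: the limit is nonsingular on the orthogonal complement, or its column space belongs
  -- to `JJ`.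
  by_cases hker : ∀ x ∈ (M0lin X R)ᗮ, A *ᵥ x.ofLp = 0 → x = 0
  · have htop : colSpan G' ⊔ M0lin X R = ⊤ := top_le_iff.1 (sup_eq_top_of_forall hpsd hker ▸ hsub)
    obtain ⟨y₀, hy₀⟩ := exists_notMem_Bset hRX
    have hd := ae_denom_ne_zero hn hX hw (htop ▸ Submodule.mem_top) hy₀ (G := G')
    refine ⟨hd, fun c _ => ?_⟩
    obtain ⟨y, hy⟩ := exists_numer_ne (w := w) hn hq hX hR hw hRX c
    exact ae_Tw_ne hn hX hd (htop ▸ Submodule.mem_top) hy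
  · push Not at hker
    obtain ⟨x, hx, hAx, hx0⟩ := hker
    have hr := rank_add_finrank_lt hAL hx hx0 hAx
    obtain ⟨Γ, hΓ, hΓA⟩ := exists_mem_SS_colSpan_le hL hF (fun j => hf (φ j)) hAlim hr
    obtain ⟨y₀, hy₀, hy₀B⟩ := hB Γ hΓ _ hΓA
    have hd := ae_denom_ne_zero hn hX hw (hsub hy₀) hy₀B
    refine ⟨hd, fun c hc => ?_⟩
    by_cases hlev : ∀ s ∈ colSpan A, levelFun w X R c s = 0
    -- If the level polynomial vanishes on `colSpan A`, the statistic is almost everywhere `c`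
    -- there, so `c ≤ Cstar`.
    · refine absurd hc (not_lt.2 (le_sSup ⟨colSpan A, ⟨A, ?_, hr, rfl⟩, c, rfl, ?_⟩))
      · exact mem_closure_of_tendsto hAlim (Eventually.of_forall fun j =>
          ⟨_, ⟨f (φ j), hf _, rfl⟩, rfl⟩)
      · obtain ⟨μ₀, hμ₀⟩ := M0_nonempty (X := X) (r := r) hR
        exact ⟨μ₀, hμ₀, ae_lebAffine_Tw_eq hn hX hw hy₀ hy₀B hlev hμ₀⟩
    · push Not at hlev
      obtain ⟨s, hs, hs0⟩ := hlev
      exact ae_Tw_ne hn hX hd (hsub (Submodule.mem_sup_left hs)) hs0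

/-! ### Almost sure convergence along sequences of roots. -/

theorem ae_tendsto_Tw (hn : n ≠ 0) {G : ℕ → Matrix (Fin n) (Fin n) ℝ}
    {G' : Matrix (Fin n) (Fin n) ℝ} (h : Tendsto G atTop (𝓝 G'))
    (hd : ∀ᵐ z ∂stdGaussian (EuclideanSpace ℝ (Fin n)),
        denom w X R (toEuclideanCLM (𝕜 := ℝ) G' z) ≠ 0) :
    ∀ᵐ z ∂stdGaussian (EuclideanSpace ℝ (Fin n)),
      Tendsto (fun j => Tw w X R 0 (toEuclideanCLM (𝕜 := ℝ) (G j) z)) atTop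
        (𝓝 (Tw w X R 0 (toEuclideanCLM (𝕜 := ℝ) G' z))) := by
  filter_upwards [hd] with z hz
  have h1 : Continuous fun G : Matrix (Fin n) (Fin n) ℝ => toEuclideanCLM (𝕜 := ℝ) G z :=
    (PiLp.continuous_toLp 2 _).comp (continuous_id.matrix_mulVec continuous_const)
  exact (continuousAt_Tw_zero hn hz).tendsto.comp ((h1.tendsto G').comp h)

theorem tendsto_measure_zero_of_ae {Ω : Type*} [MeasurableSpace Ω] {μ : Measure Ω}
    [IsFiniteMeasure μ] {B : ℕ → Set Ω} (hB : ∀ j, MeasurableSet (B j))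
    (h : ∀ᵐ z ∂μ, ∀ᶠ j in atTop, z ∉ B j) : Tendsto (fun j => μ (B j)) atTop (𝓝 0) := by
  rw [← measure_empty (μ := μ)]
  refine tendsto_measure_of_ae_tendsto_indicator_of_isFiniteMeasure atTop MeasurableSet.empty hB ?_
  filter_upwards [h] with z hz
  filter_upwards [hz] with j hj
  simp [hj]

end SizeControl

namespace SizeControl
open MeasureTheory Filter Topology ProbabilityTheory
open Matrix (toEuclideanCLM)

/-! ### The size as a function of the critical value -/

variable {n k q : ℕ} {X : Matrix (Fin n) (Fin k) ℝ} {R : Matrix (Fin q) (Fin k) ℝ}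
  {r : Fin q → ℝ} {w : ℤ → ℝ} {F : Set (ℝ → ℝ)}

theorem size_antitone (M₀ : Set (EuclideanSpace ℝ (Fin n))) (F : Set (ℝ → ℝ))
    (T : EuclideanSpace ℝ (Fin n) → ℝ) : Antitone (size M₀ F T) := by
  intro C C' h
  unfold size
  gcongr

theorem measurable_Tw_root (hn : n ≠ 0) (G : Matrix (Fin n) (Fin n) ℝ) :
    Measurable fun z => Tw w X R 0 (toEuclideanCLM (𝕜 := ℝ) G z) :=
  (measurable_Tw_zero hn).comp (toEuclideanCLM (𝕜 := ℝ) G).continuous.measurable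

/-- Otherwise each critical value `j` has a root with rejection probability above `a`. Along a
convergent subsequence the statistics converge to a finite limit while the critical values diverge.
-/
theorem exists_size_le (hkn : k < n) (hq : 1 ≤ q) (hX : X.rank = k) (hR : R.rank = q)
    (hw : AssumptionAW n w) (hRX : AssumptionRX X R) (hF : F ⊆ Fall) (hB : AvoidsB X R F)
    {a : ENNReal} (ha : 0 < a) : ∃ C : ℝ, size (M0 X R r) F (Tw w X R r) C ≤ a := by
  have hn : n ≠ 0 := by omega
  by_contra! hcon
  have h1 : ∀ j : ℕ, ∃ G ∈ roots (M0lin X R) F, a < stdGaussian (EuclideanSpace ℝ (Fin n))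
      {z | (j : ℝ) ≤ Tw w X R 0 (toEuclideanCLM (𝕜 := ℝ) G z)} := by
    intro j
    have h2 := hcon j
    rw [size_eq_iSup_roots hkn hX hR hF] at h2
    simpa only [lt_iSup_iff, exists_prop] using h2
  choose G hG hGa using h1
  obtain ⟨G', φ, hφ, hlim, hd, -⟩ := exists_limit_root (r := r) hkn hq hX hR hw hRX hF hB hG
  have h0 := tendsto_measure_zero_of_ae (μ := stdGaussian (EuclideanSpace ℝ (Fin n)))
    (B := fun j => {z | (φ j : ℝ) ≤ Tw w X R 0 (toEuclideanCLM (𝕜 := ℝ) (G (φ j)) z)})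
    (fun j => measurableSet_le measurable_const (measurable_Tw_root hn _)) (by
      filter_upwards [ae_tendsto_Tw hn hlim hd] with z hz
      have h2 : Tendsto (fun j => (φ j : ℝ)) atTop atTop :=
        tendsto_natCast_atTop_atTop.comp hφ.tendsto_atTop
      filter_upwards [hz.eventually_lt_const (lt_add_one _), h2.eventually_ge_atTop _]
        with j h3 h4
      exact not_le.2 (h3.trans_le h4))
  exact absurd ha (not_lt.2 (ge_of_tendsto' h0 fun j => (hGa (φ j)).le))

theorem exists_lt_size (hkn : k < n) (hX : X.rank = k) (hR : R.rank = q) (hF : F ⊆ Fall)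
    (hFne : F.Nonempty) {a : ENNReal} (ha : a < 1) :
    ∃ C : ℝ, a < size (M0 X R r) F (Tw w X R r) C := by
  have hn : n ≠ 0 := by omega
  obtain ⟨f, hf⟩ := hFne
  set G := covRoot (M0lin X R) ((1 : ℝ) • Sig n f) with hG
  have hGr : G ∈ roots (M0lin X R) F := ⟨1, Set.mem_Ioi.2 one_pos, f, hf, rfl⟩
  have h0 := tendsto_measure_zero_of_ae (μ := stdGaussian (EuclideanSpace ℝ (Fin n)))
    (B := fun j : ℕ => {z | -(j : ℝ) ≤ Tw w X R 0 (toEuclideanCLM (𝕜 := ℝ) G z)}ᶜ)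
    (fun j => (measurableSet_le measurable_const (measurable_Tw_root hn _)).compl) (by
      refine Eventually.of_forall fun z => ?_
      filter_upwards [tendsto_natCast_atTop_atTop.eventually_ge_atTop
        (-Tw w X R 0 (toEuclideanCLM (𝕜 := ℝ) G z))] with j hj
      simp only [Set.mem_compl_iff, not_not, Set.mem_ofPred_eq]
      linarith)
  obtain ⟨j, hj⟩ := (h0.eventually_lt_const (tsub_pos_of_lt ha)).exists
  refine ⟨-(j : ℝ), ?_⟩
  rw [size_eq_iSup_roots hkn hX hR hF]
  refine lt_of_lt_of_le ?_ (le_iSup₂_of_le G hGr le_rfl)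
  rw [prob_compl_eq_one_sub (measurableSet_le measurable_const (measurable_Tw_root hn _))] at hj
  by_contra! hle
  exact absurd hj (not_lt.2 (tsub_le_tsub_left hle 1))

/-- Right continuity of the size. -/
theorem size_le_of_forall_gt (hkn : k < n) (hq : 1 ≤ q) (hX : X.rank = k) (hR : R.rank = q)
    (hw : AssumptionAW n w) (hRX : AssumptionRX X R) (hF : F ⊆ Fall) {a : ENNReal} {C : ℝ}
    (h : ∀ C' > C, size (M0 X R r) F (Tw w X R r) C' ≤ a) :
    size (M0 X R r) F (Tw w X R r) C ≤ a := by
  have hn : n ≠ 0 := by omega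
  rw [size_eq_iSup_roots hkn hX hR hF]
  refine iSup₂_le fun G hG => ?_
  have h1 : ∀ C' > C, stdGaussian (EuclideanSpace ℝ (Fin n))
      {z | C' ≤ Tw w X R 0 (toEuclideanCLM (𝕜 := ℝ) G z)} ≤ a := by
    intro C' hC'
    have h2 := h C' hC'
    rw [size_eq_iSup_roots hkn hX hR hF] at h2
    exact (le_iSup₂_of_le G hG le_rfl).trans h2
  have h0 := tendsto_measure_zero_of_ae (μ := stdGaussian (EuclideanSpace ℝ (Fin n)))
    (B := fun j : ℕ => {z | C ≤ Tw w X R 0 (toEuclideanCLM (𝕜 := ℝ) G z)} \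
      {z | C + 1 / ((j : ℝ) + 1) ≤ Tw w X R 0 (toEuclideanCLM (𝕜 := ℝ) G z)})
    (fun j => (measurableSet_le measurable_const (measurable_Tw_root hn _)).diff
      (measurableSet_le measurable_const (measurable_Tw_root hn _))) (by
      -- Without an atom at `C`, almost every point leaves the shrinking gap between the two
      -- rejection regions.
      filter_upwards [ae_Tw_root_ne hkn hq hX hR hw hRX hF hG C] with z hz
      rcases lt_or_gt_of_ne hz with hz | hz
      · exact Eventually.of_forall fun j hj => hz.not_ge hj.1
      · have h2 : Tendsto (fun j : ℕ => C + 1 / ((j : ℝ) + 1)) atTop (𝓝 (C + 0)) :=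
          tendsto_const_nhds.add tendsto_one_div_add_atTop_nhds_zero_nat
        rw [add_zero] at h2
        filter_upwards [h2.eventually_lt_const hz] with j hj hj'
        exact hj'.2 hj.le)
  have h2 := (tendsto_const_nhds (x := a)).add h0
  rw [add_zero] at h2
  refine ge_of_tendsto' h2 fun j => ?_
  refine (measure_mono (t := {z | C + 1 / ((j : ℝ) + 1) ≤
    Tw w X R 0 (toEuclideanCLM (𝕜 := ℝ) G z)} ∪ _) ?_).trans ((measure_union_le _ _).trans
      (add_le_add (h1 _ (by have : (0 : ℝ) < 1 / ((j : ℝ) + 1) := by positivity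
                            linarith)) le_rfl))
  rw [Set.union_sdiff_self]
  exact Set.subset_union_right

/-- Left continuity of the size at critical values larger than `Cstar`. -/
theorem le_size_of_forall_lt (hkn : k < n) (hq : 1 ≤ q) (hX : X.rank = k) (hR : R.rank = q)
    (hw : AssumptionAW n w) (hRX : AssumptionRX X R) (hF : F ⊆ Fall) (hB : AvoidsB X R F)
    {a : ENNReal} {C : ℝ}
    (hC : Cstar (M0 X R r) (M0lin X R) F (Tw w X R r) < (C : EReal))
    (h : ∀ C' < C, a ≤ size (M0 X R r) F (Tw w X R r) C') :
    a ≤ size (M0 X R r) F (Tw w X R r) C := by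
  have hn : n ≠ 0 := by omega
  by_contra! hlt
  -- The strict gap lets the suprema at `C - 1/(j+1)` be replaced by individual roots exceeding `b`.
  obtain ⟨b, hb1, hb2⟩ := exists_between hlt
  have h1 : ∀ j : ℕ, ∃ G ∈ roots (M0lin X R) F, b < stdGaussian (EuclideanSpace ℝ (Fin n))
      {z | C - 1 / ((j : ℝ) + 1) ≤ Tw w X R 0 (toEuclideanCLM (𝕜 := ℝ) G z)} := by
    intro j
    have h2 := hb2.trans_le (h (C - 1 / ((j : ℝ) + 1)) (by
      have : (0 : ℝ) < 1 / ((j : ℝ) + 1) := by positivity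
      linarith))
    rw [size_eq_iSup_roots hkn hX hR hF] at h2
    simpa only [lt_iSup_iff, exists_prop] using h2
  choose G hG hGb using h1
  obtain ⟨G', φ, hφ, hlim, hd, hCs⟩ := exists_limit_root (r := r) hkn hq hX hR hw hRX hF hB hG
  have h0 := tendsto_measure_zero_of_ae (μ := stdGaussian (EuclideanSpace ℝ (Fin n)))
    (B := fun j : ℕ => {z | C - 1 / ((φ j : ℝ) + 1) ≤
        Tw w X R 0 (toEuclideanCLM (𝕜 := ℝ) (G (φ j)) z)} \
      {z | C ≤ Tw w X R 0 (toEuclideanCLM (𝕜 := ℝ) (G (φ j)) z)})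
    (fun j => (measurableSet_le measurable_const (measurable_Tw_root hn _)).diff
      (measurableSet_le measurable_const (measurable_Tw_root hn _))) (by
      filter_upwards [ae_tendsto_Tw hn hlim hd, hCs C hC] with z hz hne
      have h2 : Tendsto (fun j : ℕ => C - 1 / ((φ j : ℝ) + 1)) atTop (𝓝 (C - 0)) :=
        tendsto_const_nhds.sub
          (tendsto_one_div_add_atTop_nhds_zero_nat.comp hφ.tendsto_atTop)
      rw [sub_zero] at h2
      rcases lt_or_gt_of_ne hne with hlt | hgt
      · filter_upwards [hz.eventually_lt h2 hlt] with j hj hj'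
        exact hj.not_ge hj'.1
      · filter_upwards [hz.eventually_const_lt hgt] with j hj hj'
        exact hj'.2 hj.le)
  have h2 := (tendsto_const_nhds (x := size (M0 X R r) F (Tw w X R r) C)).add h0
  rw [add_zero] at h2
  refine absurd hb1 (not_lt.2 (ge_of_tendsto' h2 fun j => (hGb (φ j)).le.trans ?_))
  have h3 : stdGaussian (EuclideanSpace ℝ (Fin n))
      {z | C ≤ Tw w X R 0 (toEuclideanCLM (𝕜 := ℝ) (G (φ j)) z)} ≤
        size (M0 X R r) F (Tw w X R r) C := by
    rw [size_eq_iSup_roots hkn hX hR hF]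
    exact le_iSup₂_of_le (G (φ j)) (hG _) le_rfl
  refine (measure_mono (t := {z | C ≤ Tw w X R 0 (toEuclideanCLM (𝕜 := ℝ) (G (φ j)) z)} ∪ _)
    ?_).trans ((measure_union_le _ _).trans (add_le_add h3 le_rfl))
  rw [Set.union_sdiff_self]
  exact Set.subset_union_right

/-- Let `C₀` be the infimum of critical values of size at most `a`. Above `Cstar`, two-sided
continuity gives equality at `C₀`; if `C₀ ≤ Cstar`, then `Cstar` itself works, squeezed by `s Cstar
≤ s C₀ ≤ a ≤ alphaStar ≤ s Cstar`. -/
theorem exists_size_eq (hkn : k < n) (hq : 1 ≤ q) (hX : X.rank = k) (hR : R.rank = q)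
    (hw : AssumptionAW n w) (hRX : AssumptionRX X R) (hF : F ⊆ Fall) (hFne : F.Nonempty)
    (hB : AvoidsB X R F) {a : ENNReal} (ha0 : 0 < a) (ha1 : a < 1)
    (ha : a ≤ alphaStar (M0 X R r) (M0lin X R) F (Tw w X R r)) :
    ∃ C : ℝ, size (M0 X R r) F (Tw w X R r) C = a := by
  set s := size (M0 X R r) F (Tw w X R r) with hs
  have hanti : Antitone s := size_antitone _ _ _
  have hne : {C | s C ≤ a}.Nonempty := exists_size_le hkn hq hX hR hw hRX hF hB ha0
  obtain ⟨C₁, hC₁⟩ := exists_lt_size (r := r) (w := w) hkn hX hR hF hFne ha1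
  have hbdd : BddBelow {C | s C ≤ a} := by
    refine ⟨C₁, fun C hC => ?_⟩
    by_contra! hlt
    exact absurd hC₁ (not_lt.2 ((hanti hlt.le).trans hC))
  set C₀ := sInf {C | s C ≤ a} with hC₀
  have hgt : ∀ C > C₀, s C ≤ a := by
    intro C hC
    obtain ⟨C', hC', hlt⟩ := exists_lt_of_csInf_lt hne hC
    exact (hanti hlt.le).trans hC'
  have hlt : ∀ C < C₀, a ≤ s C := by
    intro C hC
    by_contra! h
    exact absurd hC (not_lt.2 (csInf_le hbdd h.le))
  have hC₀a : s C₀ ≤ a := size_le_of_forall_gt hkn hq hX hR hw hRX hF hgt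
  rcases lt_or_ge (Cstar (M0 X R r) (M0lin X R) F (Tw w X R r)) (C₀ : EReal) with h | h
  · exact ⟨C₀, hC₀a.antisymm (le_size_of_forall_lt hkn hq hX hR hw hRX hF hB h hlt)⟩
  · have htop : Cstar (M0 X R r) (M0lin X R) F (Tw w X R r) ≠ ⊤ := by
      intro htop
      -- With `Cstar = ⊤` the supremum defining `alphaStar` is empty, hence `0`.
      rw [alphaStar, htop] at ha
      simp only [not_top_lt, iSup_false, iSup_bot] at ha
      exact absurd ha0 (not_lt.2 ha)
    have hbot : Cstar (M0 X R r) (M0lin X R) F (Tw w X R r) ≠ ⊥ := fun hbot =>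
      absurd (hbot ▸ h) (not_le.2 (EReal.bot_lt_coe C₀))
    obtain ⟨c, hc⟩ : ∃ c : ℝ, Cstar (M0 X R r) (M0lin X R) F (Tw w X R r) = (c : EReal) :=
      ⟨_, (EReal.coe_toReal htop hbot).symm⟩
    rw [hc, EReal.coe_le_coe_iff] at h
    refine ⟨c, ((hanti h).trans hC₀a).antisymm (ha.trans ?_)⟩
    refine iSup₂_le fun C hC => ?_
    rw [hc, EReal.coe_lt_coe_iff] at hC
    exact hanti hC.le

/-! ### The collection `SS F L` and column spaces -/

/-- Total mass one survives weak convergence, so the support is nonempty; by symmetry it contains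
`|γ|` with each `γ`. -/
theorem nonempty_of_mem_SS {L : Submodule ℝ (EuclideanSpace ℝ (Fin n))} (hL : L ≠ ⊤)
    (hF : F ⊆ Fall) {Γ : Set ℝ} (hΓ : Γ ∈ SS F L) : Γ.Nonempty := by
  obtain ⟨m, ⟨hI, hsym, -, ⟨f, M, hf, hM, hlim⟩, -⟩, rfl⟩ := hΓ
  have hmass : m.mass = 1 := by
    refine tendsto_nhds_unique ((FiniteMeasure.continuous_mass.tendsto m).comp hlim)
      (tendsto_const_nhds.congr fun j => ?_)
    have := isProbabilityMeasure_specMeasure hL (hF (hf j))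
    rw [Function.comp_apply, ← ENNReal.coe_inj, FiniteMeasure.ennreal_mass, hM j, measure_univ,
      ENNReal.coe_one]
  have hne : (m : Measure ℝ) ≠ 0 := by
    intro h
    have h1 := m.ennreal_mass
    rw [hmass, h] at h1
    simp at h1
  obtain ⟨γ, hγ⟩ := Measure.nonempty_support hne
  have hγI : γ ∈ Set.Icc (-Real.pi) Real.pi :=
    Measure.support_subset_of_isClosed isClosed_Icc hI hγ
  have hneg : -γ ∈ (m : Measure ℝ).support := by
    rw [Measure.mem_support_iff_forall] at hγ ⊢
    intro U hU
    have h1 := hγ ((fun x => -x) ⁻¹' interior U)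
      (continuous_neg.continuousAt.preimage_mem_nhds (interior_mem_nhds.2 hU))
    rw [hsym _ isOpen_interior.measurableSet] at h1
    exact h1.trans_le (measure_mono interior_subset)
  refine ⟨|γ|, ?_, abs_mem_Icc hγI⟩
  rcases abs_choice γ with h | h <;> rw [h] <;> assumption

theorem colSpan_Eblock_le {L W : Submodule ℝ (EuclideanSpace ℝ (Fin n))} {p : ℕ} {γ : Fin p → ℝ}
    (h : ∀ i, colSpan (Erho L (γ i)) ≤ W) : colSpan (Eblock L γ) ≤ W := by
  refine Submodule.span_le.2 ?_
  rintro _ ⟨c, rfl⟩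
  exact h c.1 (Submodule.subset_span ⟨c.2, rfl⟩)

theorem colSpan_Erho_le_Eblock (L : Submodule ℝ (EuclideanSpace ℝ (Fin n))) {p : ℕ}
    (γ : Fin p → ℝ) (i : Fin p) : colSpan (Erho L (γ i)) ≤ colSpan (Eblock L γ) := by
  refine Submodule.span_le.2 ?_
  rintro _ ⟨c, rfl⟩
  exact Submodule.subset_span ⟨(i, c), rfl⟩

theorem avoidsB_of_forall_Eblock
    (h : ∀ (p : ℕ) (γ : Fin p → ℝ), Function.Injective γ → Set.range γ ∈ SS F (M0lin X R) →
      ¬ ((colSpan (Eblock (M0lin X R) γ) : Set (EuclideanSpace ℝ (Fin n))) ⊆ Bset X R)) :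
    AvoidsB X R F := by
  intro Γ hΓ W hW
  have hfin : Γ.Finite := by
    obtain ⟨m, hm, rfl⟩ := hΓ
    exact hm.2.2.1.inter_of_left _
  obtain ⟨p, γ, hγ, hrange⟩ : ∃ (p : ℕ) (γ : Fin p → ℝ), Function.Injective γ ∧
      Set.range γ = Γ := by
    refine ⟨_, Subtype.val ∘ hfin.toFinset.equivFin.symm,
      Subtype.val_injective.comp (Equiv.injective _), ?_⟩
    rw [Set.range_comp, Equiv.range_eq_univ, Set.image_univ, Subtype.range_coe]
    exact hfin.coe_toFinset
  subst hrange
  obtain ⟨y, hy, hyB⟩ := Set.not_subset.1 (h p γ hγ hΓ)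
  exact ⟨y, colSpan_Eblock_le (fun i => hW _ (Set.mem_range_self i)) hy, hyB⟩

theorem finrank_colSpan {m : Type} [Fintype m] (A : Matrix (Fin n) m ℝ) :
    Module.finrank ℝ (colSpan A) = A.rank := by
  rw [Matrix.rank_eq_finrank_span_cols,
    ← (WithLp.linearEquiv 2 ℝ (Fin n → ℝ)).finrank_map_eq (colSpan A), colSpan,
    Submodule.map_span, ← Set.range_comp]
  rfl

theorem colSpan_fromCols {m m' : Type} (A : Matrix (Fin n) m ℝ) (A' : Matrix (Fin n) m' ℝ) :
    colSpan (Matrix.fromCols A A') = colSpan A ⊔ colSpan A' := by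
  rw [colSpan, colSpan, colSpan, ← Submodule.span_union, ← Set.Sum.elim_range]
  congr 2
  ext (j | j) <;> rfl

/-- `colSpan X` has dimension `k`, so adjoining columns raises the rank exactly when they leave it.
-/
theorem not_colSpan_subset_iff_lt_rank (hX : X.rank = k)
    (hB : Bset X R = (colSpan X : Set (EuclideanSpace ℝ (Fin n)))) {m : Type} [Fintype m]
    (A : Matrix (Fin n) m ℝ) :
    ¬ ((colSpan A : Set (EuclideanSpace ℝ (Fin n))) ⊆ Bset X R) ↔
      k < (Matrix.fromCols X A).rank := by
  rw [hB, SetLike.coe_subset_coe, ← left_lt_sup, ← finrank_colSpan, colSpan_fromCols]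
  have hk : k = Module.finrank ℝ (colSpan X) := by rw [finrank_colSpan, hX]
  constructor
  · intro h
    exact hk.trans_lt (Submodule.finrank_lt_finrank_of_lt h)
  · intro h
    refine lt_of_le_of_ne le_sup_left fun h' => ?_
    rw [← h', ← hk] at h
    exact h.false

end SizeControl

/-! ### Assembly of the theorem. -/

theorem mainTheorem4 {n k q : ℕ} (hk : 1 ≤ k) (hkn : k < n) (hq : 1 ≤ q)
    (X : Matrix (Fin n) (Fin k) ℝ) (hX : X.rank = k)
    (R : Matrix (Fin q) (Fin k) ℝ) (hR : R.rank = q) (r : Fin q → ℝ)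
    (F : Set (ℝ → ℝ)) (hF : F ⊆ SizeControl.Fall) (hFne : F.Nonempty)
    (w : ℤ → ℝ) (hw : SizeControl.AssumptionAW n w) (hRX : SizeControl.AssumptionRX X R) :
    -- Part 1
    ((∀ (p : ℕ) (γ : Fin p → ℝ), Function.Injective γ →
        Set.range γ ∈ SizeControl.SS F (SizeControl.M0lin X R) →
        ¬ ((SizeControl.colSpan (SizeControl.Eblock (SizeControl.M0lin X R) γ) :
            Set (EuclideanSpace ℝ (Fin n))) ⊆ SizeControl.Bset X R)) →
      (∀ α : ℝ, 0 < α → α < 1 → ∃ C : ℝ,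
        SizeControl.size (SizeControl.M0 X R r) F (SizeControl.Tw w X R r) C
          ≤ ENNReal.ofReal α) ∧
      (∀ α : ℝ, 0 < α → α < 1 →
        ENNReal.ofReal α ≤ SizeControl.alphaStar (SizeControl.M0 X R r)
          (SizeControl.M0lin X R) F (SizeControl.Tw w X R r) →
        ∃ C : ℝ, SizeControl.size (SizeControl.M0 X R r) F (SizeControl.Tw w X R r) C
          = ENNReal.ofReal α)) ∧
    -- Part 2
    ((∀ γ ∈ ⋃₀ SizeControl.SS F (SizeControl.M0lin X R),
        ¬ ((SizeControl.colSpan (SizeControl.Erho (SizeControl.M0lin X R) γ) :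
            Set (EuclideanSpace ℝ (Fin n))) ⊆ SizeControl.Bset X R)) →
      ∀ (p : ℕ) (γ : Fin p → ℝ), Function.Injective γ →
        Set.range γ ∈ SizeControl.SS F (SizeControl.M0lin X R) →
        ¬ ((SizeControl.colSpan (SizeControl.Eblock (SizeControl.M0lin X R) γ) :
            Set (EuclideanSpace ℝ (Fin n))) ⊆ SizeControl.Bset X R)) ∧
    ((∀ γ ∈ Set.Icc 0 Real.pi,
        ¬ ((SizeControl.colSpan (SizeControl.Erho (SizeControl.M0lin X R) γ) :
            Set (EuclideanSpace ℝ (Fin n))) ⊆ SizeControl.Bset X R)) →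
      ∀ γ ∈ ⋃₀ SizeControl.SS F (SizeControl.M0lin X R),
        ¬ ((SizeControl.colSpan (SizeControl.Erho (SizeControl.M0lin X R) γ) :
            Set (EuclideanSpace ℝ (Fin n))) ⊆ SizeControl.Bset X R)) ∧
    -- Part 3
    (SizeControl.Bset X R = (SizeControl.colSpan X : Set (EuclideanSpace ℝ (Fin n))) →
      (∀ (p : ℕ) (γ : Fin p → ℝ), Function.Injective γ →
        Set.range γ ∈ SizeControl.SS F (SizeControl.M0lin X R) →
        (¬ ((SizeControl.colSpan (SizeControl.Eblock (SizeControl.M0lin X R) γ) :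
            Set (EuclideanSpace ℝ (Fin n))) ⊆ SizeControl.Bset X R) ↔
          k < (Matrix.fromCols X (SizeControl.Eblock (SizeControl.M0lin X R) γ)).rank)) ∧
      (∀ γ ∈ Set.Icc 0 Real.pi,
        (¬ ((SizeControl.colSpan (SizeControl.Erho (SizeControl.M0lin X R) γ) :
            Set (EuclideanSpace ℝ (Fin n))) ⊆ SizeControl.Bset X R) ↔
          k < (Matrix.fromCols X (SizeControl.Erho (SizeControl.M0lin X R) γ)).rank))) := by
  have hL : SizeControl.M0lin X R ≠ ⊤ := SizeControl.M0lin_ne_top hkn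
  refine ⟨fun h => ?_, ?_, ?_, fun hB => ⟨?_, ?_⟩⟩
  · have hav := SizeControl.avoidsB_of_forall_Eblock h
    refine ⟨fun α hα _ => ?_, fun α hα hα1 hle => ?_⟩
    · exact SizeControl.exists_size_le hkn hq hX hR hw hRX hF hav (ENNReal.ofReal_pos.2 hα)
    · exact SizeControl.exists_size_eq hkn hq hX hR hw hRX hF hFne hav
        (ENNReal.ofReal_pos.2 hα) (by simpa using hα1) hle
  · intro h p γ _ hγ hsub
    obtain ⟨_, i, rfl⟩ := SizeControl.nonempty_of_mem_SS hL hF hγ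
    refine h (γ i) (Set.mem_sUnion.2 ⟨_, hγ, i, rfl⟩) (subset_trans ?_ hsub)
    exact SizeControl.colSpan_Erho_le_Eblock _ γ i
  · rintro h γ ⟨_, ⟨m, _, rfl⟩, hγ⟩
    exact h γ hγ.2
  · intro p γ _ _
    exact SizeControl.not_colSpan_subset_iff_lt_rank hX hB _
  · intro γ _
    exact SizeControl.not_colSpan_subset_iff_lt_rank hX hB _
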